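/- **Setting.** Let $X\ge 0$ be a random variable with law and distribution function $F_X$ such that $\mathbb E[\log(1+X)]<\infty$. Let $0<\sigma\le 1$, let $Y_\sigma$ be a Bernoulli variable with $P(Y_\sigma=1)=\sigma=1-P(Y_\sigma=0)$, independent of $X$, and let $F_{XY_\sigma}$ be the law (and distribution function) of $XY_\sigma$. Assume that $F_{XY_\sigma}$ has no jump of size $1$, that is, $XY_\sigma$ is not almost surely constant. For $\theta>0$ and a law $F$ on $[0,\infty)$, a Dirichlet process with parameters $(\theta,F)$ is a random probability measure $P$ on $[0,\infty)$ such that, for every finite measurable partition $(C_1,\dots,C_k)$ of $[0,\infty)$, the vector $(P(C_1),\dots,P(C_k))$ has the Dirichlet distribution with parameters $(\theta F(C_1),\dots,\theta F(C_k))$; the Dirichlet mean is $M_\theta(F)=\int_0^\infty x\,P(\mathrm dx)$. Let $G_\theta$ denote a gamma$(\theta,1)$ variable and $\beta_{a,b}$ a beta$(a,b)$ variable, with $\beta_{a,0}:=1$; the two factors of a product of random variables are taken to be independent. The law of $G_\theta M_\theta(F)$ is called GGC$(\theta,F)$. Put $$\Phi_{F_X}(t)=\mathbb E\bigl[\log(|t-X|)\,\mathbf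 1(t\ne X)\bigr].$$ **Theorem.** The means $M_1(F_{XY_\sigma})$ and $M_\sigma(F_X)$ are almost surely finite, and $\Phi_{F_X}(x)$ is finite for almost every $x>0$. Moreover: 1. $M_1(F_{XY_\sigma})\stackrel{d}{=}\beta_{\sigma,1-\sigma}M_\sigma(F_X)$, and this random variable has a density, concentrated on $(0,\infty)$, given by $$\xi_{F_{XY_\sigma}}(x)=\frac{x^{\sigma-1}}{\pi}\,\sin\bigl(\pi F_{XY_\sigma}(x)\bigr)\,e^{-\sigma\Phi_{F_X}(x)},\qquad x>0,$$ where, for $x>0$, $\sin(\pi F_{XY_\sigma}(x))$ equals $\sin(\pi\sigma[1-F_X(x)])$ if $F_X(x)>0$, and $\sin(\pi(1-\sigma))$ if $F_X(x)=0$. 2. GGC$(\sigma,F_X)=$ GGC$(1,F_{XY_\sigma})$, that is, $G_\sigma M_\sigma(F_X)\stackrel{d}{=}G_1M_1(F_{XY_\sigma})$, and this random variable has a density, concentrated on $(0,\infty)$, given by $$g_{\sigma,F_X}(x)=\frac1\pi\int_0^\infty e^{-x/y}\,y^{\sigma-2}\,\sin\bigl(\pi F_{XY_\sigma}(y)\bigr)\,e^{-\sigma\Phi_{F_X}(y)}\,\mathrm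 dy,\qquad x>0,$$ where the integral converges for every $x>0$. -/

import Mathlib

open MeasureTheory ProbabilityTheory Set

namespace DirichletMeans

noncomputable section

/-- The gamma law with shape `a ≥ 0` and rate `1`, with the usual convention that the law with
shape `0` is the point mass at `0`. -/
def gammaLaw (a : ℝ) : Measure ℝ :=
  if a = 0 then Measure.dirac 0 else gammaMeasure a 1

/-- The beta law with parameters `(a, b)`, `a > 0`, `b ≥ 0`, with the convention that a
beta`(a, 0)` variable is equal to `1`. -/
def betaLaw (a b : ℝ) : Measure ℝ :=
  if b = 0 then Measure.dirac 1 else betaMeasure a b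

/-- The Dirichlet law with parameters `a i ≥ 0` (not all zero): the law of
`(G₁ / G, …, G_k / G)`, where the `G_i` are independent gamma`(a i, 1)` variables and
`G = G₁ + ⋯ + G_k`. -/
def dirichletLaw {k : ℕ} (a : Fin k → ℝ) : Measure (Fin k → ℝ) :=
  (Measure.pi fun i => gammaLaw (a i)).map fun g i => g i / ∑ j, g j

/-- The random probability measure `P` (a Markov kernel `ω ↦ P ω` from the probability space
`(Ω, μ)`) is a Dirichlet process with total mass `θ` and prior parameter `F`: for every finite
measurable partition `(C₁, …, C_k)`, the vector `(P C₁, …, P C_k)` has the Dirichlet law with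
parameters `(θ F(C₁), …, θ F(C_k))`. -/
def IsDirichletProcess {Ω E : Type*} [MeasurableSpace Ω] [MeasurableSpace E]
    (P : Kernel Ω E) (θ : ℝ) (F : Measure E) (μ : Measure Ω) : Prop :=
  ∀ (k : ℕ) (C : Fin k → Set E), (∀ i, MeasurableSet (C i)) →
    (∀ i j, i ≠ j → Disjoint (C i) (C j)) → (⋃ i, C i) = univ →
    HasLaw (fun ω i => (P ω).real (C i)) (dirichletLaw fun i => θ * F.real (C i)) μ

/-- The mean functional `ω ↦ ∫ x P(dx)` of a random probability measure on the line. If `P` is a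
Dirichlet process with parameters `(θ, F)`, this is the Dirichlet mean `M_θ(F)`. -/
def meanFunctional {Ω : Type*} [MeasurableSpace Ω] (P : Kernel Ω ℝ) (ω : Ω) : ℝ :=
  ∫ x, x ∂(P ω)

/-- The integrand `x ↦ log |t - x| 𝟙(t ≠ x)` of `Φ_F(t)`. -/
def logKernel (t : ℝ) : ℝ → ℝ :=
  {x : ℝ | t ≠ x}.indicator fun x => Real.log |t - x|

/-- `Φ_F(t) = ∫ log |t - x| 𝟙(t ≠ x) F(dx)`. -/
def Phi (F : Measure ℝ) (t : ℝ) : ℝ := ∫ x, logKernel t x ∂F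

/-- `ξ(x) = (x ^ (σ - 1) / π) sin (π F_{XY}(x)) exp (-σ Φ_{F_X}(x))`, where `FX`, `FXY` are the
laws of `X` and of `X Y_σ`. -/
def xiDensity (σ : ℝ) (FX FXY : Measure ℝ) (x : ℝ) : ℝ :=
  x ^ (σ - 1) / Real.pi * Real.sin (Real.pi * cdf FXY x) * Real.exp (-σ * Phi FX x)

/-- The integrand `y ↦ exp (-x / y) y ^ (σ - 2) sin (π F_{XY}(y)) exp (-σ Φ_{F_X}(y))` of the
gamma mixture at the point `x`. -/
def mixIntegrand (σ : ℝ) (FX FXY : Measure ℝ) (x y : ℝ) : ℝ :=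
  Real.exp (-(x / y)) * y ^ (σ - 2) * Real.sin (Real.pi * cdf FXY y) *
    Real.exp (-σ * Phi FX y)

/-- `g(x) = (1 / π) ∫₀^∞ exp (-x / y) y ^ (σ - 2) sin (π F_{XY}(y)) exp (-σ Φ_{F_X}(y)) dy`. -/
def mixDensity (σ : ℝ) (FX FXY : Measure ℝ) (x : ℝ) : ℝ :=
  1 / Real.pi * ∫ y in Ioi (0 : ℝ), mixIntegrand σ FX FXY x y

/-- The measure on the line with density `f` on `(0, ∞)` and no mass elsewhere. -/
def lawOfDensity (f : ℝ → ℝ) : Measure ℝ :=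
  (volume.restrict (Ioi 0)).withDensity fun x => ENNReal.ofReal (f x)

end

end DirichletMeans

/-!
Both parts of the theorem come from one computation. If `P` is a Dirichlet process with parameters
`(θ, F)`, its mean `M` satisfies the Markov–Krein identity
`E (1 + s M) ^ (-θ) = exp (-θ ∫ log (1 + s x) F(dx))`. For the law of `X Y_σ`, which is
`σ F_X + (1 - σ) δ₀`, the right-hand side with `θ = 1` equals the one for `(σ, F_X)`, because
`log (1 + s x)` vanishes at the origin. Multiplying by an independent gamma variable turns
`E (1 + s M) ^ (-θ)` into a Laplace transform, so the two gamma mixtures have the same law;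
multiplying `M_σ(F_X)` by an independent beta`(σ, 1 - σ)` variable turns it into
`E (1 + s β M)⁻¹`, so `β M_σ(F_X)` and `M₁(F_{XY})` have the same Stieltjes transform
(`integral_exp_gamma_mul`, `integral_inv_beta_mul`).

The Markov–Krein identity for Dirichlet vectors (`integral_dirichletLaw`) says that a sum of
independent gamma variables is a gamma variable independent of the proportions
(`map_sum_proportions`). This follows from uniqueness of Laplace transforms on the half-line, since
exponential tilting rescales all the gamma variables and leaves the proportions unchanged. Monotone
approximation by simple functions gives the identity for Dirichlet processes with a `[0, ∞]`-valued
mean (`lintegral_dirichletProcess_rpow`), and `s → 0` shows that the mean is almost surely finite.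

The density comes from Stieltjes inversion (`eq_withDensity_meanDensity`). The identity with `θ = 1`
extends to the slit plane by analytic continuation. Its imaginary part at `-t + iε` expresses the
Poisson smoothing of the law of `M` as `exp (-∫ log |x - t + iε| F(dx)) sin (∫ arg (x - t + iε)
F(dx))`, which tends to `exp (-Φ_F(t)) sin (π F(t))` for almost every `t`. Since `F` has no jump of
size one, each point has a neighbourhood of mass `p < 1`, where Jensen's inequality bounds the
smoothed law by a multiple of `1 + p⁻¹ ∫ |t - x| ^ (-p) F(dx)`, which is locally integrable
(`exp_neg_integral_log_le`). By dominated convergence the law of `M` agrees near every point with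
the limiting density, so it has no singular part.
-/

namespace DirichletMeans

open Filter Topology
open scoped ENNReal NNReal

/-! ### Laplace transforms determine laws on the half-line -/

/-- Finite measures on `[0, 1]` with the same moments agree, by the Weierstrass theorem. -/
lemma measure_eq_of_moments_eq {μ ν : Measure ℝ} [IsFiniteMeasure μ] [IsFiniteMeasure ν]
    (hμ : ∀ᵐ x ∂μ, x ∈ Icc (0 : ℝ) 1) (hν : ∀ᵐ x ∂ν, x ∈ Icc (0 : ℝ) 1)
    (h : ∀ n : ℕ, ∫ x, x ^ n ∂μ = ∫ x, x ^ n ∂ν) : μ = ν := by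
  have hpow : ∀ (κ : Measure ℝ) [IsFiniteMeasure κ], (∀ᵐ x ∂κ, x ∈ Icc (0 : ℝ) 1) →
      ∀ n : ℕ, Integrable (fun x : ℝ => x ^ n) κ := by
    intro κ _ hκ n
    refine Integrable.of_bound (by fun_prop) 1 ?_
    filter_upwards [hκ] with x hx
    rw [norm_pow, Real.norm_of_nonneg hx.1]
    exact pow_le_one₀ hx.1 hx.2
  have hpoly : ∀ (κ : Measure ℝ) [IsFiniteMeasure κ], (∀ᵐ x ∂κ, x ∈ Icc (0 : ℝ) 1) →
      ∀ p : Polynomial ℝ, Integrable (fun x => p.eval x) κ ∧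
        ∫ x, p.eval x ∂κ = p.sum fun n c => c * ∫ x, x ^ n ∂κ := by
    intro κ _ hκ p
    simp only [Polynomial.eval_eq_sum, Polynomial.sum_def]
    refine ⟨integrable_finsetSum _ fun n _ => (hpow κ hκ n).const_mul _, ?_⟩
    rw [integral_finsetSum _ fun n _ => (hpow κ hκ n).const_mul _]
    simp only [integral_const_mul]
  refine ext_of_forall_integral_eq_of_IsFiniteMeasure fun f => ?_
  refine eq_of_forall_dist_le fun ε hε => ?_
  rw [Real.dist_eq]
  set K : ℝ := μ.real univ + ν.real univ + 1 with hK
  have hμ0 : 0 ≤ μ.real univ := measureReal_nonneg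
  have hν0 : 0 ≤ ν.real univ := measureReal_nonneg
  have hKpos : 0 < K := by positivity
  obtain ⟨p, hp⟩ := exists_polynomial_near_of_continuousOn 0 1 f f.continuous.continuousOn
    (ε / K) (by positivity)
  have hdist : ∀ (κ : Measure ℝ) [IsFiniteMeasure κ], (∀ᵐ x ∂κ, x ∈ Icc (0 : ℝ) 1) →
      |∫ x, f x ∂κ - ∫ x, p.eval x ∂κ| ≤ ε / K * κ.real univ := by
    intro κ _ hκ
    rw [← integral_sub (f.integrable κ) (hpoly κ hκ p).1, ← Real.norm_eq_abs]
    refine norm_integral_le_of_norm_le_const ?_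
    filter_upwards [hκ] with x hx
    rw [Real.norm_eq_abs, abs_sub_comm]
    exact (hp x hx).le
  have h1 := hdist μ hμ
  have h2 := hdist ν hν
  have h3 : ∫ x, p.eval x ∂μ = ∫ x, p.eval x ∂ν := by
    rw [(hpoly μ hμ p).2, (hpoly ν hν p).2]
    simp only [h]
  rw [h3] at h1
  have h4 : ε / K * μ.real univ + ε / K * ν.real univ ≤ ε := by
    rw [← mul_add, div_mul_eq_mul_div, div_le_iff₀ hKpos]
    nlinarith
  rw [abs_le] at *
  constructor <;> linarith [h1.1, h1.2, h2.1, h2.2]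

/-- A finite measure on `[0, ∞)` is determined by the values of its Laplace transform at the
natural numbers. -/
lemma measure_eq_of_laplace_eq {μ ν : Measure ℝ} [IsFiniteMeasure μ] [IsFiniteMeasure ν]
    (hμ : ∀ᵐ x ∂μ, 0 ≤ x) (hν : ∀ᵐ x ∂ν, 0 ≤ x)
    (h : ∀ n : ℕ, ∫ x, Real.exp (-(n * x)) ∂μ = ∫ x, Real.exp (-(n * x)) ∂ν) : μ = ν := by
  have he : Measurable fun x : ℝ => Real.exp (-x) := by fun_prop
  have hmem : ∀ κ : Measure ℝ, (∀ᵐ x ∂κ, 0 ≤ x) →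
      ∀ᵐ y ∂κ.map (fun x => Real.exp (-x)), y ∈ Icc (0 : ℝ) 1 := by
    intro κ hκ
    refine (ae_map_iff (p := fun y => y ∈ Icc (0 : ℝ) 1) he.aemeasurable measurableSet_Icc).2 ?_
    filter_upwards [hκ] with x hx
    exact ⟨(Real.exp_pos _).le, Real.exp_le_one_iff.2 (by linarith)⟩
  have hmap : μ.map (fun x => Real.exp (-x)) = ν.map (fun x => Real.exp (-x)) := by
    refine measure_eq_of_moments_eq (hmem μ hμ) (hmem ν hν) fun n => ?_
    rw [integral_map he.aemeasurable (by fun_prop), integral_map he.aemeasurable (by fun_prop)]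
    simpa only [← Real.exp_nat_mul, mul_neg] using h n
  have hback : ∀ κ : Measure ℝ,
      (κ.map (fun x => Real.exp (-x))).map (fun y => -Real.log y) = κ := by
    intro κ
    rw [Measure.map_map (by fun_prop) he]
    convert Measure.map_id using 2
    ext x
    simp
  rw [← hback μ, hmap, hback ν]

/-! ### Gamma laws and the independence of the total and the proportions -/

lemma gammaLaw_zero : gammaLaw 0 = Measure.dirac 0 := by simp [gammaLaw]

lemma gammaLaw_of_pos {a : ℝ} (ha : 0 < a) : gammaLaw a = gammaMeasure a 1 := by
  simp [gammaLaw, ha.ne']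

lemma isProbabilityMeasure_gammaLaw {a : ℝ} (ha : 0 ≤ a) : IsProbabilityMeasure (gammaLaw a) := by
  rcases ha.eq_or_lt with rfl | ha
  · rw [gammaLaw_zero]; infer_instance
  · rw [gammaLaw_of_pos ha]; exact isProbabilityMeasure_gammaMeasure ha one_pos

lemma ae_gammaLaw_nonneg {a : ℝ} (ha : 0 ≤ a) : ∀ᵐ x ∂gammaLaw a, 0 ≤ x := by
  rcases ha.eq_or_lt with rfl | ha
  · rw [gammaLaw_zero, ae_dirac_iff measurableSet_Ici]
  · rw [gammaLaw_of_pos ha, gammaMeasure, ae_withDensity_iff (by unfold gammaPDF; fun_prop)]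
    refine ae_of_all _ fun x hx => ?_
    by_contra hneg
    exact hx (gammaPDF_of_neg (not_le.1 hneg))

/-- Exponential tilting of a gamma law is a rescaling. -/
lemma lintegral_exp_mul_gammaLaw {a : ℝ} (ha : 0 ≤ a) {l : ℝ} (hl : 0 ≤ l)
    {h : ℝ → ℝ≥0∞} (hh : Measurable h) :
    ∫⁻ x, ENNReal.ofReal (Real.exp (-(l * x))) * h x ∂gammaLaw a =
      ENNReal.ofReal ((1 + l) ^ (-a)) * ∫⁻ x, h (x / (1 + l)) ∂gammaLaw a := by
  have hl1 : 0 < 1 + l := by linarith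
  rcases ha.eq_or_lt with rfl | ha
  · rw [gammaLaw_zero, lintegral_dirac' _ (by fun_prop), lintegral_dirac' _ (by fun_prop)]
    simp
  · have hpdf : ∀ r, Measurable (gammaPDF a r) := fun r => by unfold gammaPDF; fun_prop
    rw [gammaLaw_of_pos ha, gammaMeasure,
      lintegral_withDensity_eq_lintegral_mul _ (hpdf 1) (by fun_prop),
      lintegral_withDensity_eq_lintegral_mul _ (hpdf 1) (by fun_prop)]
    conv_rhs => rw [← Real.smul_map_volume_mul_left hl1.ne']
    rw [lintegral_smul_measure, lintegral_map (by fun_prop) (by fun_prop), abs_of_pos hl1,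
      smul_eq_mul, ← mul_assoc, ← lintegral_const_mul _ (by fun_prop)]
    refine lintegral_congr fun x => ?_
    simp only [Pi.mul_apply]
    rw [mul_div_cancel_left₀ _ hl1.ne', ← mul_assoc, ← mul_assoc]
    congr 1
    rcases lt_or_ge x 0 with hx | hx
    · rw [gammaPDF_of_neg hx, gammaPDF_of_neg (by nlinarith)]; simp
    · rw [gammaPDF_of_nonneg hx, gammaPDF_of_nonneg (by positivity),
        ← ENNReal.ofReal_mul (by positivity), ← ENNReal.ofReal_mul (by positivity),
        ← ENNReal.ofReal_mul (by positivity)]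
      congr 1
      have e1 : Real.exp (-(1 * ((1 + l) * x))) = Real.exp (-(1 * x)) * Real.exp (-(l * x)) := by
        rw [← Real.exp_add]; congr 1; ring
      have e2 : (1 + l) ^ (-a) * (1 + l) * (1 + l) ^ (a - 1) = 1 := by
        rw [← Real.rpow_add_one hl1.ne', ← Real.rpow_add hl1]; simp
      rw [e1, Real.mul_rpow hl1.le hx]
      linear_combination (-(1 ^ a / Real.Gamma a * x ^ (a - 1) * Real.exp (-(1 * x)) *
        Real.exp (-(l * x)))) * e2

lemma integral_exp_gammaLaw {a : ℝ} (ha : 0 ≤ a) {l : ℝ} (hl : 0 ≤ l) :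
    ∫ x, Real.exp (-(l * x)) ∂gammaLaw a = (1 + l) ^ (-a) := by
  have := isProbabilityMeasure_gammaLaw ha
  rw [integral_eq_lintegral_of_nonneg_ae (ae_of_all _ fun x => (Real.exp_pos _).le) (by fun_prop)]
  have := lintegral_exp_mul_gammaLaw ha hl (h := fun _ => 1) measurable_const
  simp only [mul_one, lintegral_const, measure_univ] at this
  rw [this, ENNReal.toReal_ofReal (by positivity)]

/-- A product of densities is the density of the product measure. -/
lemma pi_withDensity {ι : Type*} [Fintype ι] (γ : ι → Measure ℝ) [∀ i, IsProbabilityMeasure (γ i)]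
    (f : ι → ℝ → ℝ≥0∞) (hf : ∀ i, Measurable (f i))
    (hfin : ∀ i, IsFiniteMeasure ((γ i).withDensity (f i))) :
    Measure.pi (fun i => (γ i).withDensity (f i)) =
      (Measure.pi γ).withDensity fun x => ∏ i, f i (x i) := by
  refine Measure.pi_eq fun s hs => ?_
  rw [withDensity_apply _ (MeasurableSet.univ_pi hs),
    ← lintegral_indicator (MeasurableSet.univ_pi hs)]
  have hind : iIndepFun (fun i (x : ι → ℝ) => (s i).indicator (f i) (x i)) (Measure.pi γ) :=
    iIndepFun_pi fun i => ((hf i).indicator (hs i)).aemeasurable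
  have hprod := lintegral_prod_eq_prod_lintegral_of_indepFun Finset.univ _ hind
    fun i => ((hf i).indicator (hs i)).comp (measurable_pi_apply i)
  have hcongr : ∀ x : ι → ℝ, (univ.pi s).indicator (fun x => ∏ i, f i (x i)) x =
      ∏ i, (s i).indicator (f i) (x i) := by
    intro x
    by_cases hx : x ∈ univ.pi s
    · rw [indicator_of_mem hx]
      exact Finset.prod_congr rfl fun i _ => (indicator_of_mem (hx i (mem_univ i)) _).symm
    · rw [indicator_of_notMem hx]
      simp only [mem_univ_pi, not_forall] at hx
      obtain ⟨i, hi⟩ := hx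
      exact (Finset.prod_eq_zero (Finset.mem_univ i) (indicator_of_notMem hi _)).symm
  simp only [hcongr]
  rw [hprod]
  refine Finset.prod_congr rfl fun i _ => ?_
  rw [withDensity_apply _ (hs i), ← lintegral_indicator (hs i)]
  exact (measurePreserving_eval γ i).lintegral_comp ((hf i).indicator (hs i))

/-- Exponential tilting of independent gamma variables by their sum rescales them all. -/
lemma lintegral_exp_mul_pi_gammaLaw {ι : Type*} [Fintype ι] {a : ι → ℝ} (ha : ∀ i, 0 ≤ a i)
    {l : ℝ} (hl : 0 ≤ l) {h : (ι → ℝ) → ℝ≥0∞} (hh : Measurable h) :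
    ∫⁻ g, ENNReal.ofReal (Real.exp (-(l * ∑ i, g i))) * h g ∂Measure.pi (fun i => gammaLaw (a i)) =
      ENNReal.ofReal ((1 + l) ^ (-∑ i, a i)) *
        ∫⁻ g, h (fun i => g i / (1 + l)) ∂Measure.pi (fun i => gammaLaw (a i)) := by
  have hl1 : 0 < 1 + l := by linarith
  have := fun i => isProbabilityMeasure_gammaLaw (ha i)
  have hmap : ∀ i, (gammaLaw (a i)).withDensity (fun x => ENNReal.ofReal (Real.exp (-(l * x)))) =
      ENNReal.ofReal ((1 + l) ^ (-a i)) • (gammaLaw (a i)).map (fun x => x / (1 + l)) := by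
    intro i
    ext s hs
    rw [withDensity_apply _ hs, ← lintegral_indicator hs, Measure.smul_apply,
      Measure.map_apply (by fun_prop) hs, smul_eq_mul]
    have := lintegral_exp_mul_gammaLaw (ha i) hl (h := s.indicator 1)
      (measurable_one.indicator hs)
    have h2 : ∀ x, s.indicator (1 : ℝ → ℝ≥0∞) (x / (1 + l)) =
        ((fun x => x / (1 + l)) ⁻¹' s).indicator 1 x := fun x => rfl
    simp only [h2] at this
    rw [lintegral_indicator_one (by exact (measurable_id.div_const _) hs)] at this
    rw [← this]
    refine lintegral_congr fun x => ?_
    by_cases hx : x ∈ s <;> simp [hx]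
  have hfin : ∀ i, IsFiniteMeasure
      ((gammaLaw (a i)).withDensity (fun x => ENNReal.ofReal (Real.exp (-(l * x))))) := by
    intro i
    rw [hmap i]
    exact ⟨by rw [Measure.smul_apply, Measure.map_apply (by fun_prop) .univ]; simp⟩
  have hpi := pi_withDensity (fun i => gammaLaw (a i))
    (fun _ x => ENNReal.ofReal (Real.exp (-(l * x)))) (fun _ => by fun_prop) hfin
  have hpi' : Measure.pi (fun i => (gammaLaw (a i)).withDensity
        (fun x => ENNReal.ofReal (Real.exp (-(l * x))))) =
      ENNReal.ofReal ((1 + l) ^ (-∑ i, a i)) •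
        (Measure.pi fun i => gammaLaw (a i)).map (fun g i => g i / (1 + l)) := by
    have hpm : ∀ i, IsProbabilityMeasure ((gammaLaw (a i)).map (fun x => x / (1 + l))) :=
      fun i => Measure.isProbabilityMeasure_map (by fun_prop)
    refine Measure.pi_eq fun s hs => ?_
    rw [Measure.pi_map_pi (f := fun _ x => x / (1 + l)) (fun i => by fun_prop),
      Measure.smul_apply, Measure.pi_pi, smul_eq_mul]
    simp only [hmap, Measure.smul_apply, smul_eq_mul]
    rw [Finset.prod_mul_distrib, ← ENNReal.ofReal_prod_of_nonneg fun i _ => by positivity,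
      ← Real.rpow_sum_of_pos hl1, Finset.sum_neg_distrib]
  rw [hpi] at hpi'
  have hdens : ∀ g : ι → ℝ, ∏ i, ENNReal.ofReal (Real.exp (-(l * g i))) =
      ENNReal.ofReal (Real.exp (-(l * ∑ i, g i))) := by
    intro g
    rw [← ENNReal.ofReal_prod_of_nonneg fun i _ => (Real.exp_pos _).le, ← Real.exp_sum,
      Finset.sum_neg_distrib, Finset.mul_sum]
  simp only [hdens] at hpi'
  have hfinal := congrArg (fun m : Measure (ι → ℝ) => ∫⁻ g, h g ∂m) hpi'
  beta_reduce at hfinal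
  rw [lintegral_withDensity_eq_lintegral_mul _ (by fun_prop) hh, lintegral_smul_measure,
    lintegral_map hh (by fun_prop)] at hfinal
  simpa using hfinal


lemma proportions_div {ι : Type*} [Fintype ι] (g : ι → ℝ) {c : ℝ} (hc : c ≠ 0) :
    (fun i => g i / c / ∑ j, g j / c) = fun i => g i / ∑ j, g j := by
  ext i
  rw [← Finset.sum_div, div_div_div_cancel_right₀ hc]

lemma isProbabilityMeasure_dirichletLaw {k : ℕ} {a : Fin k → ℝ} (ha : ∀ i, 0 ≤ a i) :
    IsProbabilityMeasure (dirichletLaw a) := by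
  have := fun i => isProbabilityMeasure_gammaLaw (ha i)
  exact Measure.isProbabilityMeasure_map (by fun_prop)

lemma ae_pi_gammaLaw_nonneg {ι : Type*} [Fintype ι] {a : ι → ℝ} (ha : ∀ i, 0 ≤ a i) :
    ∀ᵐ g ∂Measure.pi (fun i => gammaLaw (a i)), ∀ i, 0 ≤ g i := by
  have := fun i => isProbabilityMeasure_gammaLaw (ha i)
  rw [eventually_countable_forall]
  exact fun i => (Measure.quasiMeasurePreserving_eval _ i).ae (ae_gammaLaw_nonneg (ha i))

/-- The sum of independent gamma variables is a gamma variable independent of the proportions.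
Weighting by an event about the proportions, which are invariant under scaling, only multiplies
the Laplace transform of the sum by a constant. -/
lemma map_sum_proportions {k : ℕ} {a : Fin k → ℝ} (ha : ∀ i, 0 ≤ a i) :
    (Measure.pi fun i => gammaLaw (a i)).map (fun g => (∑ i, g i, fun i => g i / ∑ j, g j)) =
      (gammaLaw (∑ i, a i)).prod (dirichletLaw a) := by
  have hθ : 0 ≤ ∑ i, a i := Finset.sum_nonneg fun i _ => ha i
  have := fun i => isProbabilityMeasure_gammaLaw (ha i)
  have := isProbabilityMeasure_gammaLaw hθ
  have := isProbabilityMeasure_dirichletLaw ha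
  set π := Measure.pi fun i => gammaLaw (a i) with hπ
  have hD : Measurable fun (g : Fin k → ℝ) i => g i / ∑ j, g j := by fun_prop
  have hT : Measurable fun g : Fin k → ℝ => ∑ i, g i := by fun_prop
  refine (Measure.prod_eq fun s t hs ht => ?_).symm
  have hA := hD ht
  have key : (π.restrict ((fun g i => g i / ∑ j, g j) ⁻¹' t)).map (fun g => ∑ i, g i) =
      dirichletLaw a t • gammaLaw (∑ i, a i) := by
    have : IsFiniteMeasure (dirichletLaw a t • gammaLaw (∑ i, a i)) :=
      Measure.smul_finite _ (measure_ne_top _ _)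
    refine measure_eq_of_laplace_eq ?_ ?_ fun n => ?_
    · refine (ae_map_iff (p := fun x => 0 ≤ x) hT.aemeasurable measurableSet_Ici).2 ?_
      filter_upwards [ae_restrict_of_ae (ae_pi_gammaLaw_nonneg ha)] with g hg
      exact Finset.sum_nonneg fun i _ => hg i
    · exact Measure.ae_smul_measure (ae_gammaLaw_nonneg hθ) _
    · rw [integral_smul_measure, integral_exp_gammaLaw hθ n.cast_nonneg,
        integral_map hT.aemeasurable (by fun_prop),
        integral_eq_lintegral_of_nonneg_ae (ae_of_all _ fun x => (Real.exp_pos _).le)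
          (by fun_prop), ← lintegral_indicator hA]
      have h1 := lintegral_exp_mul_pi_gammaLaw ha (l := n) n.cast_nonneg
        (h := ((fun (g : Fin k → ℝ) i => g i / ∑ j, g j) ⁻¹' t).indicator 1)
        (measurable_one.indicator hA)
      have h2 : ∀ g : Fin k → ℝ,
          ((fun (g : Fin k → ℝ) i => g i / ∑ j, g j) ⁻¹' t).indicator (1 : (Fin k → ℝ) → ℝ≥0∞)
            (fun i => g i / (1 + n)) =
          ((fun (g : Fin k → ℝ) i => g i / ∑ j, g j) ⁻¹' t).indicator
            (1 : (Fin k → ℝ) → ℝ≥0∞) g := by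
        intro g
        have hiff : (fun i => g i / (1 + (n : ℝ))) ∈
              (fun (g : Fin k → ℝ) i => g i / ∑ j, g j) ⁻¹' t ↔
            g ∈ (fun (g : Fin k → ℝ) i => g i / ∑ j, g j) ⁻¹' t :=
          iff_of_eq (congrArg (· ∈ t) (proportions_div g (by positivity)))
        by_cases hg : g ∈ (fun (g : Fin k → ℝ) i => g i / ∑ j, g j) ⁻¹' t
        · rw [indicator_of_mem hg, indicator_of_mem (hiff.2 hg), Pi.one_apply, Pi.one_apply]
        · rw [indicator_of_notMem hg, indicator_of_notMem (mt hiff.1 hg)]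
      simp only [h2] at h1
      rw [lintegral_indicator_one hA] at h1
      have h3 : dirichletLaw a t = π ((fun (g : Fin k → ℝ) i => g i / ∑ j, g j) ⁻¹' t) :=
        Measure.map_apply hD ht
      rw [h3, smul_eq_mul, mul_comm, ← ENNReal.toReal_ofReal
        (by positivity : (0 : ℝ) ≤ (1 + n) ^ (-∑ i, a i)), ← ENNReal.toReal_mul, ← h1]
      congr 1
      refine lintegral_congr fun g => ?_
      by_cases hg : g ∈ (fun (g : Fin k → ℝ) i => g i / ∑ j, g j) ⁻¹' t
      · simp only [indicator_of_mem hg, Pi.one_apply, mul_one]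
      · simp only [indicator_of_notMem hg, mul_zero]
  rw [Measure.map_apply (hT.prodMk hD) (hs.prod ht), mul_comm]
  have h4 := congrArg (fun m : Measure ℝ => m s) key
  simp only [Measure.smul_apply, smul_eq_mul] at h4
  rw [← h4, Measure.map_apply hT hs, Measure.restrict_apply (hT hs)]
  rfl

lemma ae_dirichletLaw_nonneg {k : ℕ} {a : Fin k → ℝ} (ha : ∀ i, 0 ≤ a i) :
    ∀ᵐ d ∂dirichletLaw a, ∀ i, 0 ≤ d i := by
  rw [eventually_countable_forall]
  intro i
  refine (ae_map_iff (p := fun d : Fin k → ℝ => 0 ≤ d i) (by fun_prop)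
    (measurableSet_le measurable_const (measurable_pi_apply i))).2 ?_
  filter_upwards [ae_pi_gammaLaw_nonneg ha] with g hg
  exact div_nonneg (hg i) (Finset.sum_nonneg fun j _ => hg j)

/-- The Markov–Krein identity for a Dirichlet vector: both sides are the Laplace transform of
`∑ c i * g i` for independent gamma variables, written as their sum times `∑ c i * d i`. -/
lemma integral_dirichletLaw {k : ℕ} {a c : Fin k → ℝ} (ha : ∀ i, 0 ≤ a i) (hc : ∀ i, 0 ≤ c i) :
    ∫ d, (1 + ∑ i, c i * d i) ^ (-∑ i, a i) ∂dirichletLaw a = ∏ i, (1 + c i) ^ (-a i) := by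
  have hθ : 0 ≤ ∑ i, a i := Finset.sum_nonneg fun i _ => ha i
  have := fun i => isProbabilityMeasure_gammaLaw (ha i)
  have := isProbabilityMeasure_gammaLaw hθ
  have := isProbabilityMeasure_dirichletLaw ha
  set F : ℝ × (Fin k → ℝ) → ℝ := fun p => Real.exp (-(p.1 * ∑ i, c i * p.2 i)) with hF
  have hFm : Measurable F := by fun_prop
  have hFint : Integrable F ((gammaLaw (∑ i, a i)).prod (dirichletLaw a)) := by
    refine Integrable.of_bound hFm.aestronglyMeasurable 1 ?_
    have h1 : ∀ᵐ p ∂(gammaLaw (∑ i, a i)).prod (dirichletLaw a), 0 ≤ p.1 :=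
      Measure.quasiMeasurePreserving_fst.ae (ae_gammaLaw_nonneg hθ)
    have h2 : ∀ᵐ p ∂(gammaLaw (∑ i, a i)).prod (dirichletLaw a), ∀ i, 0 ≤ p.2 i :=
      Measure.quasiMeasurePreserving_snd.ae (ae_dirichletLaw_nonneg ha)
    filter_upwards [h1, h2] with p hp1 hp2
    rw [Real.norm_of_nonneg (Real.exp_pos _).le, Real.exp_le_one_iff, neg_nonpos]
    exact mul_nonneg hp1 (Finset.sum_nonneg fun i _ => mul_nonneg (hc i) (hp2 i))
  calc ∫ d, (1 + ∑ i, c i * d i) ^ (-∑ i, a i) ∂dirichletLaw a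
      = ∫ d, ∫ t, F (t, d) ∂gammaLaw (∑ i, a i) ∂dirichletLaw a := by
        refine integral_congr_ae ?_
        filter_upwards [ae_dirichletLaw_nonneg ha] with d hd
        rw [← integral_exp_gammaLaw hθ (Finset.sum_nonneg fun i _ => mul_nonneg (hc i) (hd i))]
        simp only [hF, mul_comm]
    _ = ∫ p, F p ∂(gammaLaw (∑ i, a i)).prod (dirichletLaw a) := (integral_prod_symm F hFint).symm
    _ = ∫ g, F (∑ i, g i, fun i => g i / ∑ j, g j) ∂Measure.pi fun i => gammaLaw (a i) := by
        rw [← map_sum_proportions ha, integral_map (by fun_prop) hFm.aestronglyMeasurable]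
    _ = ∫ g : Fin k → ℝ, ∏ i, Real.exp (-(c i * g i)) ∂Measure.pi fun i => gammaLaw (a i) := by
        refine integral_congr_ae ?_
        filter_upwards [ae_pi_gammaLaw_nonneg ha] with g hg
        simp only [hF]
        rw [← Real.exp_sum, Finset.sum_neg_distrib]
        congr 2
        rw [Finset.mul_sum]
        refine Finset.sum_congr rfl fun i _ => ?_
        -- If the total vanishes, so does every coordinate.
        by_cases h0 : ∑ j, g j = 0
        · rw [(Finset.sum_eq_zero_iff_of_nonneg fun i _ => hg i).1 h0 i (Finset.mem_univ i)]
          simp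
        · field_simp
    _ = ∏ i, (1 + c i) ^ (-a i) := by
        rw [integral_fintype_prod_eq_prod (fun i x => Real.exp (-(c i * x)))]
        exact Finset.prod_congr rfl fun i _ => integral_exp_gammaLaw (ha i) (hc i)

/-! ### The Markov–Krein identity for Dirichlet processes -/

/-- The Markov–Krein identity for the mean of a simple function, which is a linear functional of
a Dirichlet vector. -/
lemma integral_simpleFunc_rpow {Ω E : Type*} [MeasurableSpace Ω] [MeasurableSpace E]
    {P : Kernel Ω E} [IsMarkovKernel P] {θ : ℝ} (hθ : 0 ≤ θ) {F : Measure E}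
    [IsProbabilityMeasure F] {μ : Measure Ω} (hP : IsDirichletProcess P θ F μ)
    (f : SimpleFunc E ℝ) (hf : ∀ x, 0 ≤ f x) :
    ∫ ω, (1 + ∫ x, f x ∂P ω) ^ (-θ) ∂μ = Real.exp (-θ * ∫ x, Real.log (1 + f x) ∂F) := by
  classical
  set e : Fin f.range.card ≃ f.range := f.range.equivFin.symm
  set C : Fin f.range.card → Set E := fun i => f ⁻¹' {(e i : ℝ)} with hC
  have hsum : ∀ u : ℝ → ℝ, ∑ x ∈ f.range, u x = ∑ i, u (e i) := by
    intro u
    rw [← Finset.sum_coe_sort, e.sum_comp fun x => u x]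
  have hunion : (⋃ i, C i) = univ := by
    refine eq_univ_of_forall fun x => mem_iUnion.2 ⟨e.symm ⟨f x, f.mem_range_self x⟩, ?_⟩
    simp [hC]
  have hdisj : ∀ i j, i ≠ j → Disjoint (C i) (C j) := by
    intro i j hij
    refine Disjoint.preimage _ (disjoint_singleton.2 fun h => hij ?_)
    exact e.injective (Subtype.ext h)
  have hlaw := hP _ C (fun i => f.measurableSet_fiber _) hdisj hunion
  have hc : ∀ i, 0 ≤ (e i : ℝ) := by
    intro i
    obtain ⟨x, hx⟩ := SimpleFunc.mem_range.1 (e i).2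
    rw [← hx]
    exact hf x
  have hint : ∀ (m : Measure E) [IsProbabilityMeasure m],
      ∫ x, f x ∂m = ∑ i, (e i : ℝ) * m.real (C i) := by
    intro m _
    rw [← f.integral_eq_integral f.integrable_of_isFiniteMeasure, f.integral_eq,
      hsum fun x => m.real (f ⁻¹' {x}) • x]
    exact Finset.sum_congr rfl fun i _ => by rw [smul_eq_mul, mul_comm]
  have hlog : ∫ x, Real.log (1 + f x) ∂F = ∑ i, F.real (C i) * Real.log (1 + e i) := by
    have := SimpleFunc.map_integral (μ := F) f (fun y => Real.log (1 + y))
      f.integrable_of_isFiniteMeasure (by simp)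
    rw [hsum fun x => F.real (f ⁻¹' {x}) • Real.log (1 + x)] at this
    simp only [smul_eq_mul] at this
    rw [← this, SimpleFunc.integral_eq_integral _ (SimpleFunc.integrable_of_isFiniteMeasure _)]
    simp
  have htot : ∑ i, θ * F.real (C i) = θ := by
    rw [← Finset.mul_sum, ← measureReal_biUnion_finset (fun i _ j _ hij => hdisj i j hij)
      (fun i _ => f.measurableSet_fiber _)]
    simp [hunion]
  have hMK := integral_dirichletLaw (a := fun i => θ * F.real (C i)) (c := fun i => (e i : ℝ))
    (fun i => mul_nonneg hθ measureReal_nonneg) hc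
  rw [htot] at hMK
  have hcomp := hlaw.integral_comp (f := fun d => (1 + ∑ i, (e i : ℝ) * d i) ^ (-θ))
    (by fun_prop : Measurable _).aestronglyMeasurable
  rw [hMK] at hcomp
  simp only [hint]
  refine Eq.trans hcomp ?_
  rw [hlog, Finset.mul_sum, Real.exp_sum]
  refine Finset.prod_congr rfl fun i _ => ?_
  rw [Real.rpow_def_of_pos (by linarith [hc i])]
  congr 1
  ring

/-- The Markov–Krein identity for a nonnegative integrand. The random integral is
`[0, ∞]`-valued, with `∞ ^ (-θ) = 0`. -/
lemma lintegral_dirichletProcess_rpow {Ω E : Type*} [MeasurableSpace Ω] [MeasurableSpace E]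
    {P : Kernel Ω E} [IsMarkovKernel P] {θ : ℝ} (hθ : 0 < θ) {F : Measure E}
    [IsProbabilityMeasure F] {μ : Measure Ω} [IsProbabilityMeasure μ]
    (hP : IsDirichletProcess P θ F μ) {f : E → ℝ} (hf : Measurable f) (hf0 : ∀ x, 0 ≤ f x)
    (hlog : Integrable (fun x => Real.log (1 + f x)) F) :
    ∫⁻ ω, (1 + ∫⁻ x, ENNReal.ofReal (f x) ∂P ω) ^ (-θ) ∂μ =
      ENNReal.ofReal (Real.exp (-θ * ∫ x, Real.log (1 + f x) ∂F)) := by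
  set φ : ℕ → SimpleFunc E ℝ≥0∞ := SimpleFunc.eapprox fun x => ENNReal.ofReal (f x) with hφ
  have hfm : Measurable fun x => ENNReal.ofReal (f x) := by fun_prop
  have hφtop : ∀ n x, φ n x ≠ ∞ := fun n x => (SimpleFunc.eapprox_lt_top _ n x).ne
  have hφle : ∀ n x, φ n x ≤ ENNReal.ofReal (f x) := by
    intro n x
    rw [← SimpleFunc.iSup_eapprox_apply hfm x]
    exact le_iSup (fun n => (SimpleFunc.eapprox (fun x => ENNReal.ofReal (f x)) n) x) n
  have hφlim : ∀ x, Tendsto (fun n => φ n x) atTop (𝓝 (ENNReal.ofReal (f x))) :=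
    fun x => SimpleFunc.tendsto_eapprox hfm x
  set g : ℕ → SimpleFunc E ℝ := fun n => (φ n).map ENNReal.toReal with hg
  have hg0 : ∀ n x, 0 ≤ g n x := fun n x => ENNReal.toReal_nonneg
  have hgle : ∀ n x, g n x ≤ f x := fun n x => ENNReal.toReal_le_of_le_ofReal (hf0 x) (hφle n x)
  have hglim : ∀ x, Tendsto (fun n => g n x) atTop (𝓝 (f x)) := by
    intro x
    have := (ENNReal.tendsto_toReal ENNReal.ofReal_ne_top).comp (hφlim x)
    rwa [ENNReal.toReal_ofReal (hf0 x)] at this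
  have hone : ∀ m : ℝ≥0∞, (1 + m) ^ (-θ) ≤ 1 := by
    intro m
    rw [ENNReal.rpow_neg]
    exact ENNReal.inv_le_one.2 (ENNReal.one_le_rpow le_self_add hθ)
  have hstep : ∀ n, ∫⁻ ω, (1 + ∫⁻ x, φ n x ∂P ω) ^ (-θ) ∂μ =
      ENNReal.ofReal (Real.exp (-θ * ∫ x, Real.log (1 + g n x) ∂F)) := by
    intro n
    rw [← integral_simpleFunc_rpow hθ.le hP (g n) (hg0 n)]
    have hpos : ∀ ω, 0 ≤ ∫ x, g n x ∂P ω := fun ω => integral_nonneg (hg0 n)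
    have hval : ∀ ω, (1 + ∫⁻ x, φ n x ∂P ω) ^ (-θ) =
        ENNReal.ofReal ((1 + ∫ x, g n x ∂P ω) ^ (-θ)) := by
      intro ω
      rw [← ENNReal.ofReal_rpow_of_pos (by linarith [hpos ω]),
        ENNReal.ofReal_add zero_le_one (hpos ω), ENNReal.ofReal_one,
        ofReal_integral_eq_lintegral_ofReal (SimpleFunc.integrable_of_isFiniteMeasure _)
          (ae_of_all _ (hg0 n))]
      simp [hg, ENNReal.ofReal_toReal (hφtop n _)]
    simp only [hval]
    have hmeas : Measurable fun ω => ∫ x, g n x ∂P ω :=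
      ((g n).measurable.stronglyMeasurable.integral_kernel).measurable
    refine (ofReal_integral_eq_lintegral_ofReal ?_ (ae_of_all _ fun ω => ?_)).symm
    · refine Integrable.of_bound ((hmeas.const_add 1).pow_const _).aestronglyMeasurable 1
        (ae_of_all _ fun ω => ?_)
      rw [Real.norm_of_nonneg (Real.rpow_nonneg (by linarith [hpos ω]) _)]
      exact Real.rpow_le_one_of_one_le_of_nonpos (by linarith [hpos ω]) (by linarith)
    · exact Real.rpow_nonneg (by linarith [hpos ω]) _
  have hL : Tendsto (fun n => ∫⁻ ω, (1 + ∫⁻ x, φ n x ∂P ω) ^ (-θ) ∂μ) atTop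
      (𝓝 (∫⁻ ω, (1 + ∫⁻ x, ENNReal.ofReal (f x) ∂P ω) ^ (-θ) ∂μ)) := by
    refine tendsto_lintegral_of_dominated_convergence (fun _ => 1) (fun n => ?_)
      (fun n => ae_of_all _ fun ω => hone _) (by simp) (ae_of_all _ fun ω => ?_)
    · have : Measurable fun ω => ∫⁻ x, φ n x ∂P ω := (φ n).measurable.lintegral_kernel
      fun_prop
    · refine ((ENNReal.continuous_rpow_const (y := -θ)).tendsto _).comp
        (tendsto_const_nhds.add ?_)
      exact lintegral_tendsto_of_tendsto_of_monotone (fun n => (φ n).measurable.aemeasurable)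
        (ae_of_all _ fun x => fun m n hmn => SimpleFunc.monotone_eapprox _ hmn x)
        (ae_of_all _ hφlim)
  have hR : Tendsto (fun n => ENNReal.ofReal (Real.exp (-θ * ∫ x, Real.log (1 + g n x) ∂F))) atTop
      (𝓝 (ENNReal.ofReal (Real.exp (-θ * ∫ x, Real.log (1 + f x) ∂F)))) := by
    refine ENNReal.tendsto_ofReal ((Real.continuous_exp.tendsto _).comp
      (Tendsto.const_mul _ ?_))
    refine tendsto_integral_of_dominated_convergence _
      (fun n => ((g n).measurable.const_add 1).log.aestronglyMeasurable) hlog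
      (fun n => ae_of_all _ fun x => ?_) (ae_of_all _ fun x => ?_)
    · rw [Real.norm_of_nonneg (Real.log_nonneg (by linarith [hg0 n x]))]
      exact Real.log_le_log (by linarith [hg0 n x]) (by linarith [hgle n x])
    · exact ((hglim x).const_add 1).log (by linarith [hf0 x])
  simp only [hstep] at hL
  exact tendsto_nhds_unique hL hR

/-- A measurable function with integrable logarithm `log (1 + f)` has a finite mean under almost
every realisation of the Dirichlet process: let `s → 0` in the Markov–Krein identity for `s f`. -/
lemma ae_lintegral_dirichletProcess_lt_top {Ω E : Type*} [MeasurableSpace Ω] [MeasurableSpace E]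
    {P : Kernel Ω E} [IsMarkovKernel P] {θ : ℝ} (hθ : 0 < θ) {F : Measure E}
    [IsProbabilityMeasure F] {μ : Measure Ω} [IsProbabilityMeasure μ]
    (hP : IsDirichletProcess P θ F μ) {f : E → ℝ} (hf : Measurable f) (hf0 : ∀ x, 0 ≤ f x)
    (hlog : Integrable (fun x => Real.log (1 + f x)) F) :
    ∀ᵐ ω ∂μ, ∫⁻ x, ENNReal.ofReal (f x) ∂P ω < ∞ := by
  set I : Ω → ℝ≥0∞ := fun ω => ∫⁻ x, ENNReal.ofReal (f x) ∂P ω with hI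
  have hIm : Measurable I :=
    (by fun_prop : Measurable fun x => ENNReal.ofReal (f x)).lintegral_kernel
  set s : ℕ → ℝ := fun n => 1 / ((n : ℝ) + 1) with hs
  have hs0 : ∀ n, 0 < s n := fun n => Nat.one_div_pos_of_nat
  have hs1 : ∀ n, s n ≤ 1 := fun n => by
    rw [hs]; exact (div_le_one (by positivity)).2 (by linarith [(n.cast_nonneg : (0 : ℝ) ≤ n)])
  have hslim : Tendsto s atTop (𝓝 0) := tendsto_one_div_add_atTop_nhds_zero_nat
  have hbd : ∀ n x, ‖Real.log (1 + s n * f x)‖ ≤ Real.log (1 + f x) := by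
    intro n x
    have h1 : 0 ≤ s n * f x := mul_nonneg (hs0 n).le (hf0 x)
    rw [Real.norm_of_nonneg (Real.log_nonneg (by linarith))]
    refine Real.log_le_log (by linarith) ?_
    nlinarith [hs1 n, hf0 x]
  have hint : ∀ n, Integrable (fun x => Real.log (1 + s n * f x)) F := fun n =>
    hlog.mono' (by fun_prop : Measurable _).aestronglyMeasurable (ae_of_all _ (hbd n))
  have hMK : ∀ n, ENNReal.ofReal (Real.exp (-θ * ∫ x, Real.log (1 + s n * f x) ∂F)) ≤
      μ {ω | I ω < ∞} := by
    intro n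
    rw [← lintegral_dirichletProcess_rpow hθ hP (hf.const_mul (s n))
      (fun x => mul_nonneg (hs0 n).le (hf0 x)) (hint n),
      ← lintegral_indicator_one (measurableSet_lt hIm measurable_const)]
    refine lintegral_mono fun ω => ?_
    simp only [ENNReal.ofReal_mul (hs0 n).le]
    rw [lintegral_const_mul _ (by fun_prop)]
    change (1 + ENNReal.ofReal (s n) * I ω) ^ (-θ) ≤ _
    by_cases h : I ω < ∞
    · rw [indicator_of_mem (by exact h), ENNReal.rpow_neg]
      exact ENNReal.inv_le_one.2 (ENNReal.one_le_rpow le_self_add hθ)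
    · rw [not_lt, top_le_iff] at h
      -- an infinite mean contributes `∞ ^ (-θ) = 0`
      rw [h, ENNReal.mul_top (by simpa using hs0 n), add_top,
        ENNReal.top_rpow_of_neg (by linarith)]
      exact bot_le
  have hlim : Tendsto (fun n => ENNReal.ofReal
      (Real.exp (-θ * ∫ x, Real.log (1 + s n * f x) ∂F))) atTop (𝓝 1) := by
    have h1 : Tendsto (fun n => ∫ x, Real.log (1 + s n * f x) ∂F) atTop (𝓝 (∫ _, 0 ∂F)) := by
      refine tendsto_integral_of_dominated_convergence _
        (fun n => (hint n).aestronglyMeasurable) hlog (fun n => ae_of_all _ (hbd n))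
        (ae_of_all _ fun x => ?_)
      have h2 : Tendsto (fun n => 1 + s n * f x) atTop (𝓝 (1 + 0 * f x)) :=
        (hslim.mul_const _).const_add 1
      simpa using h2.log (by simp)
    have h3 := ENNReal.tendsto_ofReal ((Real.continuous_exp.tendsto _).comp (h1.const_mul (-θ)))
    simpa [Function.comp_def] using h3
  have hge : 1 ≤ μ {ω | I ω < ∞} := le_of_tendsto' hlim hMK
  exact (prob_compl_eq_zero_iff (measurableSet_lt hIm measurable_const)).2
    (le_antisymm prob_le_one hge)

/-- Null sets of the parameter are null sets of almost every realisation. -/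
lemma ae_dirichletProcess_eq_zero {Ω E : Type*} [MeasurableSpace Ω] [MeasurableSpace E]
    {P : Kernel Ω E} [IsMarkovKernel P] {θ : ℝ} (hθ : 0 < θ) {F : Measure E}
    [IsProbabilityMeasure F] {μ : Measure Ω} [IsProbabilityMeasure μ]
    (hP : IsDirichletProcess P θ F μ) {s : Set E} (hs : MeasurableSet s) (hF : F s = 0) :
    ∀ᵐ ω ∂μ, P ω s = 0 := by
  have hlaw := hP 2 ![s, sᶜ] (by simp [Fin.forall_fin_two, hs])
    (by simp [Fin.forall_fin_two, disjoint_compl_right, disjoint_compl_left])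
    (by ext x; simp [Fin.exists_fin_two, em])
  have h0 : ∀ᵐ d ∂dirichletLaw (fun i => θ * F.real (![s, sᶜ] i)), d 0 = 0 := by
    have := fun i => isProbabilityMeasure_gammaLaw (a := θ * F.real (![s, sᶜ] i))
      (mul_nonneg hθ.le measureReal_nonneg)
    refine (ae_map_iff (p := fun d : Fin 2 → ℝ => d 0 = 0) (by fun_prop)
      (measurableSet_eq_fun (measurable_pi_apply 0) measurable_const)).2 ?_
    have h1 : ∀ᵐ x ∂gammaLaw (θ * F.real (![s, sᶜ] 0)), x = 0 := by
      have : θ * F.real (![s, sᶜ] 0) = 0 := by simp [measureReal_def, hF]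
      rw [this, gammaLaw_zero]
      exact (ae_dirac_iff (p := fun x : ℝ => x = 0) (measurableSet_singleton 0)).2 rfl
    filter_upwards [(Measure.quasiMeasurePreserving_eval _ (0 : Fin 2)).ae h1] with g hg
    have hg' : g 0 = 0 := hg
    simp [hg']
  rw [← hlaw.map_eq] at h0
  filter_upwards [ae_of_ae_map hlaw.aemeasurable h0] with ω hω
  exact (measureReal_eq_zero_iff).1 hω

lemma integrable_log_one_add_mul {E : Type*} [MeasurableSpace E] {F : Measure E}
    [IsFiniteMeasure F] {f : E → ℝ} (hf : Measurable f) (hf0 : ∀ᵐ x ∂F, 0 ≤ f x)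
    (hlog : Integrable (fun x => Real.log (1 + f x)) F) {s : ℝ} (hs : 0 ≤ s) :
    Integrable (fun x => Real.log (1 + s * f x)) F := by
  refine ((integrable_const (Real.log (1 + s))).add hlog).mono'
    (by fun_prop : Measurable _).aestronglyMeasurable ?_
  filter_upwards [hf0] with x hx
  have h1 : 0 ≤ s * f x := mul_nonneg hs hx
  rw [Real.norm_of_nonneg (Real.log_nonneg (by linarith)), Pi.add_apply,
    ← Real.log_mul (by linarith) (by linarith)]
  exact Real.log_le_log (by linarith) (by nlinarith)

/-- The facts about a Dirichlet mean used below: it is a finite nonnegative random variable,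
and the generalised Stieltjes transform of its law is given by the Markov–Krein identity. -/
lemma meanFunctional_properties {Ω : Type*} [MeasurableSpace Ω] {P : Kernel Ω ℝ}
    [IsMarkovKernel P] {θ : ℝ} (hθ : 0 < θ) {F : Measure ℝ} [IsProbabilityMeasure F]
    {μ : Measure Ω} [IsProbabilityMeasure μ] (hP : IsDirichletProcess P θ F μ)
    (hF : ∀ᵐ x ∂F, 0 ≤ x) (hlog : Integrable (fun x => Real.log (1 + x)) F) :
    Measurable (meanFunctional P) ∧ (∀ᵐ ω ∂μ, Integrable (fun x : ℝ => x) (P ω)) ∧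
      (∀ᵐ ω ∂μ, 0 ≤ meanFunctional P ω) ∧
      ∀ s, 0 ≤ s → ∫ ω, (1 + s * meanFunctional P ω) ^ (-θ) ∂μ =
        Real.exp (-θ * ∫ x, Real.log (1 + s * x) ∂F) := by
  have hmax : ∀ᵐ x ∂F, max x 0 = x := hF.mono fun x hx => max_eq_left hx
  have hPpos : ∀ᵐ ω ∂μ, ∀ᵐ x ∂P ω, 0 ≤ x := by
    have hF' : F {x | ¬ 0 ≤ x} = 0 := hF
    exact ae_dirichletProcess_eq_zero hθ hP measurableSet_Ici.compl hF'
  have hlogmax : Integrable (fun x => Real.log (1 + max x 0)) F :=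
    hlog.congr (hmax.mono fun x hx => by simp only [hx])
  have hfin := ae_lintegral_dirichletProcess_lt_top hθ hP (f := fun x => max x 0) (by fun_prop)
    (fun x => le_max_right _ _) hlogmax
  have hmeas : Measurable (meanFunctional P) :=
    (measurable_id.stronglyMeasurable.integral_kernel (κ := P)).measurable
  have hint : ∀ᵐ ω ∂μ, Integrable (fun x : ℝ => x) (P ω) := by
    filter_upwards [hPpos, hfin] with ω h1 h2
    refine ⟨measurable_id.aestronglyMeasurable, ?_⟩
    rw [hasFiniteIntegral_iff_ofReal h1]
    refine lt_of_le_of_lt (lintegral_mono fun x => ?_) h2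
    exact ENNReal.ofReal_le_ofReal (le_max_left _ _)
  have hnonneg : ∀ᵐ ω ∂μ, 0 ≤ meanFunctional P ω := by
    filter_upwards [hPpos] with ω h1
    exact integral_nonneg_of_ae h1
  refine ⟨hmeas, hint, hnonneg, fun s hs => ?_⟩
  have hlogs : Integrable (fun x => Real.log (1 + s * max x 0)) F :=
    integrable_log_one_add_mul (by fun_prop) (ae_of_all _ fun x => le_max_right _ _) hlogmax hs
  have hMK := lintegral_dirichletProcess_rpow hθ hP (f := fun x => s * max x 0) (by fun_prop)
    (fun x => mul_nonneg hs (le_max_right _ _)) hlogs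
  have hr : ∫ x, Real.log (1 + s * x) ∂F = ∫ x, Real.log (1 + s * max x 0) ∂F :=
    integral_congr_ae (hmax.mono fun x hx => by simp only [hx])
  rw [hr, ← ENNReal.toReal_ofReal (Real.exp_pos _).le, ← hMK,
    integral_eq_lintegral_of_nonneg_ae ?_
      (((hmeas.const_mul s).const_add 1).pow_const _).aestronglyMeasurable]
  · congr 1
    refine lintegral_congr_ae ?_
    filter_upwards [hPpos, hint, hnonneg] with ω h1 h2 h3
    have h4 : 0 ≤ s * meanFunctional P ω := mul_nonneg hs h3
    have h5 : ∫⁻ x, ENNReal.ofReal (s * max x 0) ∂P ω =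
        ENNReal.ofReal (s * meanFunctional P ω) := by
      rw [meanFunctional, ← integral_const_mul,
        ofReal_integral_eq_lintegral_ofReal (h2.const_mul s)
          (h1.mono fun x hx => mul_nonneg hs hx)]
      exact lintegral_congr_ae (h1.mono fun x hx => by simp only [max_eq_left hx])
    rw [h5, ← ENNReal.ofReal_one, ← ENNReal.ofReal_add zero_le_one h4,
      ENNReal.ofReal_rpow_of_pos (by linarith)]
  · filter_upwards [hnonneg] with ω h3
    have h4 : 0 ≤ s * meanFunctional P ω := mul_nonneg hs h3
    exact Real.rpow_nonneg (by linarith) _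

/-! ### Analytic continuation of the Stieltjes transform -/

/-- Near a point of the slit plane the translates by nonnegative reals stay uniformly away
from the origin. -/
lemma exists_ball_slitPlane {w : ℂ} (hw : w ∈ Complex.slitPlane) :
    ∃ r > 0, ∀ z ∈ Metric.ball w r, ∀ x : ℝ, 0 ≤ x → r ≤ ‖z + x‖ := by
  obtain ⟨ε, hε, hball⟩ := Metric.isOpen_iff.1 Complex.isOpen_slitPlane w hw
  refine ⟨ε / 2, by positivity, fun z hz x hx => ?_⟩
  by_contra! hlt
  have hmem : ((-x : ℝ) : ℂ) ∈ Metric.ball w ε := by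
    rw [Metric.mem_ball] at *
    calc dist ((-x : ℝ) : ℂ) w ≤ dist ((-x : ℝ) : ℂ) z + dist z w := dist_triangle _ _ _
      _ < ε / 2 + ε / 2 := by
        refine add_lt_add ?_ hz
        rw [dist_comm, dist_eq_norm]
        simpa using hlt
      _ = ε := by ring
  have := hball hmem
  rw [Complex.ofReal_mem_slitPlane] at this
  linarith

lemma add_ofReal_mem_slitPlane {w : ℂ} (hw : w ∈ Complex.slitPlane) {x : ℝ} (hx : 0 ≤ x) :
    w + x ∈ Complex.slitPlane := by
  rw [Complex.mem_slitPlane_iff] at *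
  simp only [Complex.add_re, Complex.ofReal_re, Complex.add_im, Complex.ofReal_im, add_zero]
  rcases hw with h | h
  · left; linarith
  · right; exact h

lemma differentiableOn_integral_inv {m : Measure ℝ} [IsFiniteMeasure m] (hm : ∀ᵐ x ∂m, 0 ≤ x) :
    DifferentiableOn ℂ (fun w : ℂ => ∫ x : ℝ, (w + x)⁻¹ ∂m) Complex.slitPlane := by
  intro w hw
  obtain ⟨r, hr, hball⟩ := exists_ball_slitPlane hw
  have hmeas : ∀ z : ℂ, AEStronglyMeasurable (fun x : ℝ => (z + x)⁻¹) m := fun z =>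
    (by fun_prop : Measurable fun x : ℝ => (z + x)⁻¹).aestronglyMeasurable
  refine ((hasDerivAt_integral_of_dominated_loc_of_deriv_le (F := fun (z : ℂ) (x : ℝ) => (z + x)⁻¹)
    (F' := fun (z : ℂ) (x : ℝ) => -1 / (z + x) ^ 2) (bound := fun _ => 1 / r ^ 2)
    (Metric.ball_mem_nhds w hr) (Eventually.of_forall hmeas) ?_ ?_ ?_ ?_ ?_).2
      ).differentiableAt.differentiableWithinAt
  · refine Integrable.of_bound (hmeas w) r⁻¹ ?_
    filter_upwards [hm] with x hx
    rw [norm_inv]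
    exact inv_anti₀ hr (hball w (Metric.mem_ball_self hr) x hx)
  · exact (by fun_prop : Measurable fun x : ℝ => -1 / (w + x) ^ 2).aestronglyMeasurable
  · filter_upwards [hm] with x hx z hz
    rw [norm_div, norm_neg, norm_one, norm_pow]
    exact one_div_le_one_div_of_le (by positivity) (pow_le_pow_left₀ hr.le (hball z hz x hx) 2)
  · exact integrable_const _
  · filter_upwards [hm] with x hx z hz
    have h0 : z + x ≠ 0 := norm_pos_iff.1 (hr.trans_le (hball z hz x hx))
    exact ((hasDerivAt_id z).add_const (x : ℂ)).inv h0

lemma integrable_clog {F : Measure ℝ} [IsFiniteMeasure F] (hF : ∀ᵐ x ∂F, 0 ≤ x)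
    (hlog : Integrable (fun x => Real.log (1 + x)) F) {w : ℂ} (hw : w ∈ Complex.slitPlane) :
    Integrable (fun x : ℝ => Complex.log (w + x)) F := by
  obtain ⟨r, hr, hball⟩ := exists_ball_slitPlane hw
  refine (((integrable_const (|Real.log r| + Real.log (1 + ‖w‖) + Real.pi)).add hlog)).mono'
    (by fun_prop : Measurable _).aestronglyMeasurable ?_
  filter_upwards [hF] with x hx
  have h1 : r ≤ ‖w + x‖ := hball w (Metric.mem_ball_self hr) x hx
  have h2 : ‖w + x‖ ≤ (1 + ‖w‖) * (1 + x) := by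
    calc ‖w + x‖ ≤ ‖w‖ + ‖(x : ℂ)‖ := norm_add_le _ _
      _ = ‖w‖ + x := by rw [Complex.norm_of_nonneg hx]
      _ ≤ _ := by nlinarith [norm_nonneg w]
  have h3 : Real.log r ≤ Real.log ‖w + x‖ := Real.log_le_log hr h1
  have h4 : Real.log ‖w + x‖ ≤ Real.log (1 + ‖w‖) + Real.log (1 + x) := by
    rw [← Real.log_mul (by positivity) (by positivity)]
    exact Real.log_le_log (hr.trans_le h1) h2
  have h5 : 0 ≤ Real.log (1 + ‖w‖) := Real.log_nonneg (by linarith [norm_nonneg w])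
  have h6 : 0 ≤ Real.log (1 + x) := Real.log_nonneg (by linarith)
  have h7 : |Real.log ‖w + x‖| ≤ |Real.log r| + Real.log (1 + ‖w‖) + Real.log (1 + x) := by
    rw [abs_le]
    constructor <;> linarith [neg_abs_le (Real.log r), abs_nonneg (Real.log r)]
  calc ‖Complex.log (w + x)‖ ≤ |(Complex.log (w + x)).re| + |(Complex.log (w + x)).im| :=
        Complex.norm_le_abs_re_add_abs_im _
    _ = |Real.log ‖w + x‖| + |Complex.arg (w + x)| := by rw [Complex.log_re, Complex.log_im]
    _ ≤ _ := by
      have := Complex.abs_arg_le_pi (w + x)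
      simp only [Pi.add_apply]
      linarith

lemma differentiableOn_integral_clog {F : Measure ℝ} [IsFiniteMeasure F] (hF : ∀ᵐ x ∂F, 0 ≤ x)
    (hlog : Integrable (fun x => Real.log (1 + x)) F) :
    DifferentiableOn ℂ (fun w : ℂ => ∫ x : ℝ, Complex.log (w + x) ∂F) Complex.slitPlane := by
  intro w hw
  obtain ⟨r, hr, hball⟩ := exists_ball_slitPlane hw
  obtain ⟨r', hr', hball'⟩ := Metric.isOpen_iff.1 Complex.isOpen_slitPlane w hw
  have hmeas : ∀ z : ℂ, AEStronglyMeasurable (fun x : ℝ => Complex.log (z + x)) F := fun z =>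
    (by fun_prop : Measurable fun x : ℝ => Complex.log (z + x)).aestronglyMeasurable
  refine ((hasDerivAt_integral_of_dominated_loc_of_deriv_le
    (F := fun (z : ℂ) (x : ℝ) => Complex.log (z + x))
    (F' := fun (z : ℂ) (x : ℝ) => 1 / (z + x)) (bound := fun _ => 1 / r)
    (inter_mem (Metric.ball_mem_nhds w hr) (Metric.ball_mem_nhds w hr'))
    (Eventually.of_forall hmeas) (integrable_clog hF hlog hw) ?_ ?_ ?_ ?_).2
      ).differentiableAt.differentiableWithinAt
  · exact (by fun_prop : Measurable fun x : ℝ => 1 / (w + x)).aestronglyMeasurable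
  · filter_upwards [hF] with x hx z hz
    rw [norm_div, norm_one]
    exact one_div_le_one_div_of_le hr (hball z hz.1 x hx)
  · exact integrable_const _
  · filter_upwards [hF] with x hx z hz
    exact ((hasDerivAt_id z).add_const (x : ℂ)).clog
      (add_ofReal_mem_slitPlane (hball' hz.2) hx)

/-- The Markov–Krein identity with `θ = 1`, known for positive reals, extends to the slit plane. -/
lemma integral_inv_eq_exp_integral_clog {m F : Measure ℝ} [IsProbabilityMeasure m]
    [IsProbabilityMeasure F] (hm : ∀ᵐ x ∂m, 0 ≤ x) (hF : ∀ᵐ x ∂F, 0 ≤ x)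
    (hlog : Integrable (fun x => Real.log (1 + x)) F)
    (h : ∀ s, 0 ≤ s → ∫ x, (1 + s * x)⁻¹ ∂m = Real.exp (-∫ x, Real.log (1 + s * x) ∂F))
    {w : ℂ} (hw : w ∈ Complex.slitPlane) :
    ∫ x : ℝ, (w + x)⁻¹ ∂m = Complex.exp (-∫ x : ℝ, Complex.log (w + x) ∂F) := by
  have hreal : ∀ u : ℝ, 0 < u →
      ∫ x : ℝ, ((u : ℂ) + x)⁻¹ ∂m = Complex.exp (-∫ x : ℝ, Complex.log ((u : ℂ) + x) ∂F) := by
    intro u hu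
    have hint : Integrable (fun x => Real.log (u + x)) F := by
      have := (integrable_clog hF hlog (Complex.ofReal_mem_slitPlane.2 hu)).re
      refine this.congr ?_
      filter_upwards [hF] with x hx
      rw [← Complex.ofReal_add]
      exact Complex.log_ofReal_re _
    have h1 : ∫ x : ℝ, Complex.log ((u : ℂ) + x) ∂F = ((∫ x, Real.log (u + x) ∂F : ℝ) : ℂ) := by
      rw [← integral_complex_ofReal]
      refine integral_congr_ae ?_
      filter_upwards [hF] with x hx
      rw [← Complex.ofReal_add, Complex.ofReal_log (by linarith)]
    have h2 : ∫ x : ℝ, ((u : ℂ) + x)⁻¹ ∂m = ((∫ x, (u + x)⁻¹ ∂m : ℝ) : ℂ) := by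
      rw [← integral_complex_ofReal]
      refine integral_congr_ae (ae_of_all _ fun x => ?_)
      push_cast
      rfl
    rw [h1, h2, ← Complex.ofReal_neg, ← Complex.ofReal_exp]
    congr 1
    have h3 : ∫ x, (u + x)⁻¹ ∂m = u⁻¹ * ∫ x, (1 + u⁻¹ * x)⁻¹ ∂m := by
      rw [← integral_const_mul]
      refine integral_congr_ae (ae_of_all _ fun x => ?_)
      beta_reduce
      rw [← mul_inv]
      congr 1
      field_simp
    have h4 : ∫ x, Real.log (1 + u⁻¹ * x) ∂F = ∫ x, Real.log (u + x) ∂F - Real.log u := by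
      have : ∫ x, (Real.log (u + x) - Real.log u) ∂F = ∫ x, Real.log (u + x) ∂F - Real.log u := by
        rw [integral_sub hint (integrable_const _)]
        simp
      rw [← this]
      refine integral_congr_ae ?_
      filter_upwards [hF] with x hx
      rw [← Real.log_div (by linarith) hu.ne']
      congr 1
      field_simp
    rw [h3, h _ (by positivity), h4, neg_sub, Real.exp_sub, Real.exp_log hu, Real.exp_neg]
    field_simp
  have hA := (differentiableOn_integral_inv hm).analyticOnNhd Complex.isOpen_slitPlane
  have hB := ((differentiableOn_integral_clog hF hlog).neg.cexp).analyticOnNhd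
    Complex.isOpen_slitPlane
  refine AnalyticOnNhd.eqOn_of_preconnected_of_frequently_eq hA hB
    (Complex.starConvex_one_slitPlane.isPathConnected Complex.one_mem_slitPlane
      ).isConnected.isPreconnected (z₀ := 1) Complex.one_mem_slitPlane ?_ hw
  have htend : Tendsto (fun n : ℕ => ((1 + 1 / ((n : ℝ) + 1) : ℝ) : ℂ)) atTop (𝓝[≠] 1) := by
    refine tendsto_nhdsWithin_iff.2 ⟨?_, Eventually.of_forall fun n => ?_⟩
    · have h1 : Tendsto (fun n : ℕ => (1 + 1 / ((n : ℝ) + 1) : ℝ)) atTop (𝓝 (1 + 0)) :=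
        tendsto_one_div_add_atTop_nhds_zero_nat.const_add 1
      have h2 := (Complex.continuous_ofReal.tendsto _).comp h1
      simpa [Function.comp_def] using h2
    · rw [mem_compl_singleton_iff, Ne, Complex.ofReal_eq_one]
      have : 0 < 1 / ((n : ℝ) + 1) := Nat.one_div_pos_of_nat
      linarith
  exact htend.frequently (Frequently.of_forall fun n => hreal _ (by positivity))

/-- The imaginary part of the analytic identity on the line of height `ε`. -/
lemma integral_poisson_eq {m F : Measure ℝ} [IsProbabilityMeasure m]
    [IsProbabilityMeasure F] (hm : ∀ᵐ x ∂m, 0 ≤ x) (hF : ∀ᵐ x ∂F, 0 ≤ x)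
    (hlog : Integrable (fun x => Real.log (1 + x)) F)
    (h : ∀ s, 0 ≤ s → ∫ x, (1 + s * x)⁻¹ ∂m = Real.exp (-∫ x, Real.log (1 + s * x) ∂F))
    (t : ℝ) {ε : ℝ} (hε : 0 < ε) :
    ∫ x, ε / ((x - t) ^ 2 + ε ^ 2) ∂m =
      Real.exp (-∫ x, Real.log ‖(⟨x - t, ε⟩ : ℂ)‖ ∂F) *
        Real.sin (∫ x, Complex.arg ⟨x - t, ε⟩ ∂F) := by
  have hw : (⟨-t, ε⟩ : ℂ) ∈ Complex.slitPlane := by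
    rw [Complex.mem_slitPlane_iff]; right; exact hε.ne'
  have hwx : ∀ x : ℝ, (⟨-t, ε⟩ : ℂ) + x = ⟨x - t, ε⟩ := by
    intro x
    apply Complex.ext <;> simp; ring
  have hkey := congrArg Complex.im (integral_inv_eq_exp_integral_clog hm hF hlog h hw)
  have hclog := integrable_clog hF hlog hw
  have hinv : Integrable (fun x : ℝ => ((⟨-t, ε⟩ : ℂ) + x)⁻¹) m := by
    obtain ⟨r, hr, hball⟩ := exists_ball_slitPlane hw
    refine Integrable.of_bound
      (by fun_prop : Measurable fun x : ℝ => ((⟨-t, ε⟩ : ℂ) + x)⁻¹).aestronglyMeasurable r⁻¹ ?_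
    filter_upwards [hm] with x hx
    rw [norm_inv]
    exact inv_anti₀ hr (hball _ (Metric.mem_ball_self hr) x hx)
  have h1 : (∫ x : ℝ, ((⟨-t, ε⟩ : ℂ) + x)⁻¹ ∂m).im = -∫ x, ε / ((x - t) ^ 2 + ε ^ 2) ∂m := by
    rw [← integral_neg]
    refine (integral_im hinv).symm.trans (integral_congr_ae (ae_of_all _ fun x => ?_))
    simp only [hwx]
    change (Complex.im _) = _
    rw [Complex.inv_im, Complex.normSq_mk]
    simp only
    rw [neg_div]
    congr 2
    ring
  have h2 : (∫ x : ℝ, Complex.log ((⟨-t, ε⟩ : ℂ) + x) ∂F).re =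
      ∫ x, Real.log ‖(⟨x - t, ε⟩ : ℂ)‖ ∂F := by
    refine (integral_re hclog).symm.trans (integral_congr_ae (ae_of_all _ fun x => ?_))
    simp only [hwx]
    exact Complex.log_re _
  have h3 : (∫ x : ℝ, Complex.log ((⟨-t, ε⟩ : ℂ) + x) ∂F).im =
      ∫ x, Complex.arg ⟨x - t, ε⟩ ∂F := by
    refine (integral_im hclog).symm.trans (integral_congr_ae (ae_of_all _ fun x => ?_))
    simp only [hwx]
    exact Complex.log_im _
  rw [h1, Complex.exp_im, Complex.neg_re, Complex.neg_im, h2, h3, Real.sin_neg] at hkey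
  linarith

/-! ### Integrability of the logarithmic kernel -/

lemma integrableOn_abs_rpow {p : ℝ} (hp : p < 1) (a b : ℝ) :
    IntegrableOn (fun t : ℝ => |t| ^ (-p)) (Icc a b) := by
  have hloc : LocallyIntegrable (fun t : ℝ => |t| ^ (-p)) :=
    locallyIntegrable_of_norm_le_rpow (C := 1) (α := p) (by simp) (by simpa using hp)
      (ae_of_all _ fun t => by
        rw [one_mul, Real.norm_eq_abs, Real.norm_eq_abs, abs_of_nonneg (by positivity)])
      (by fun_prop : Measurable _).aestronglyMeasurable
  exact hloc.integrableOn_isCompact isCompact_Icc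

/-- For `p < 1` the Riesz potential `t ↦ ∫ |t - x| ^ (-p) F(dx)` is locally integrable. -/
lemma integrable_prod_abs_rpow (F : Measure ℝ) [IsFiniteMeasure F] {p : ℝ} (hp0 : 0 ≤ p)
    (hp : p < 1) (a b : ℝ) :
    Integrable (fun q : ℝ × ℝ => |q.1 - q.2| ^ (-p)) ((volume.restrict (Icc a b)).prod F) := by
  have hmeas : Measurable fun q : ℝ × ℝ => |q.1 - q.2| ^ (-p) := by fun_prop
  -- The integral over `[a, b]` is at most that of `|t| ^ (-p)` over `[-1, 1]`, plus `b - a`.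
  set K : ℝ := (∫ t in Icc (-1 : ℝ) 1, |t| ^ (-p)) + volume.real (Icc a b) with hK
  have hslice : ∀ x : ℝ, IntegrableOn (fun t => |t - x| ^ (-p)) (Icc a b) := by
    intro x
    have h1 := integrableOn_abs_rpow hp (a - x) (b - x)
    have h2 := (measurePreserving_sub_right volume x).integrableOn_comp_preimage
      (measurableEmbedding_subRight x) (f := fun t : ℝ => |t| ^ (-p)) (s := Icc (a - x) (b - x))
    have h3 : (fun t => t - x) ⁻¹' Icc (a - x) (b - x) = Icc a b := by
      ext t; simp
    rw [h3] at h2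
    exact h2.2 h1
  have hbound : ∀ x : ℝ, ∫ t in Icc a b, |t - x| ^ (-p) ≤ K := by
    intro x
    have hle : ∀ t : ℝ, |t - x| ^ (-p) ≤
        (Icc (x - 1) (x + 1)).indicator (fun t => |t - x| ^ (-p)) t + 1 := by
      intro t
      by_cases ht : t ∈ Icc (x - 1) (x + 1)
      · rw [indicator_of_mem ht]; linarith
      · rw [indicator_of_notMem ht, zero_add]
        refine Real.rpow_le_one_of_one_le_of_nonpos ?_ (by linarith)
        by_contra! hlt
        rw [abs_lt] at hlt
        exact ht ⟨by linarith, by linarith⟩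
    have hS : IntegrableOn (fun t => |t - x| ^ (-p)) (Icc (x - 1) (x + 1)) := by
      have h1 := integrableOn_abs_rpow hp (-1) 1
      have h2 := (measurePreserving_sub_right volume x).integrableOn_comp_preimage
        (measurableEmbedding_subRight x) (f := fun t : ℝ => |t| ^ (-p)) (s := Icc (-1) 1)
      have h3 : (fun t => t - x) ⁻¹' Icc (-1) 1 = Icc (x - 1) (x + 1) := by
        ext t
        simp only [mem_preimage, mem_Icc]
        constructor <;> rintro ⟨h, h'⟩ <;> constructor <;> linarith
      rw [h3] at h2
      exact h2.2 h1
    have hSval : ∫ t in Icc (x - 1) (x + 1), |t - x| ^ (-p) =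
        ∫ t in Icc (-1 : ℝ) 1, |t| ^ (-p) := by
      have h2 := (measurePreserving_sub_right volume x).setIntegral_preimage_emb
        (measurableEmbedding_subRight x) (fun t : ℝ => |t| ^ (-p)) (Icc (-1) 1)
      have h3 : (fun t => t - x) ⁻¹' Icc (-1) 1 = Icc (x - 1) (x + 1) := by
        ext t
        simp only [mem_preimage, mem_Icc]
        constructor <;> rintro ⟨h, h'⟩ <;> constructor <;> linarith
      rw [h3] at h2
      exact h2
    have hind : Integrable ((Icc (x - 1) (x + 1)).indicator fun t => |t - x| ^ (-p)) :=
      (integrable_indicator_iff measurableSet_Icc).2 hS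
    calc ∫ t in Icc a b, |t - x| ^ (-p)
        ≤ ∫ t in Icc a b, ((Icc (x - 1) (x + 1)).indicator (fun t => |t - x| ^ (-p)) t + 1) :=
          integral_mono (hslice x) (hind.integrableOn.add (integrable_const _)) hle
      _ = (∫ t in Icc a b, (Icc (x - 1) (x + 1)).indicator (fun t => |t - x| ^ (-p)) t) +
          volume.real (Icc a b) := by
          rw [integral_add hind.integrableOn (integrable_const _)]
          simp
      _ ≤ K := by
          rw [hK, ← hSval, ← integral_indicator (μ := volume) (f := fun t => |t - x| ^ (-p))
            (measurableSet_Icc (a := x - 1) (b := x + 1))]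
          exact add_le_add (setIntegral_le_integral hind (ae_of_all _ fun t =>
            indicator_nonneg (fun t _ => by positivity) t)) le_rfl
  rw [integrable_prod_iff' hmeas.aestronglyMeasurable]
  refine ⟨ae_of_all _ hslice, ?_⟩
  refine Integrable.of_bound ?_ K (ae_of_all _ fun x => ?_)
  · exact (hmeas.norm.stronglyMeasurable.integral_prod_left').aestronglyMeasurable
  · rw [Real.norm_of_nonneg (integral_nonneg fun t => norm_nonneg _)]
    refine le_trans (le_of_eq ?_) (hbound x)
    refine integral_congr_ae (ae_of_all _ fun t => ?_)
    exact Real.norm_of_nonneg (by positivity)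

lemma ae_integrable_abs_rpow (F : Measure ℝ) [IsFiniteMeasure F] {p : ℝ} (hp0 : 0 ≤ p)
    (hp : p < 1) : ∀ᵐ t : ℝ, Integrable (fun x => |t - x| ^ (-p)) F := by
  have hN : ∀ n : ℕ, ∀ᵐ t : ℝ, t ∈ Icc (-n : ℝ) n → Integrable (fun x => |t - x| ^ (-p)) F := by
    intro n
    rw [← ae_restrict_iff' measurableSet_Icc]
    exact (integrable_prod_abs_rpow F hp0 hp (-n) n).prod_right_ae
  filter_upwards [ae_all_iff.2 hN] with t ht
  obtain ⟨n, hn⟩ := exists_nat_ge |t|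
  exact ht n (abs_le.1 hn)

lemma logKernel_of_ne {t x : ℝ} (h : t ≠ x) : logKernel t x = Real.log |t - x| :=
  indicator_of_mem (s := {x : ℝ | t ≠ x}) h _

/-- Since `log 0 = 0`, the restriction to `t ≠ x` in the kernel changes nothing. -/
lemma logKernel_eq (t x : ℝ) : logKernel t x = Real.log |t - x| := by
  by_cases h : t = x
  · rw [logKernel, indicator_of_notMem (by simpa using h), h]; simp
  · exact logKernel_of_ne h

/-- The kernel is bounded below by `-2 |t - x| ^ (-1/2)`, which is integrable for almost every `t`,
and above by `log (1 + |t|) + log (1 + x)`. -/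
lemma ae_integrable_logKernel {F : Measure ℝ} [IsFiniteMeasure F] (hF : ∀ᵐ x ∂F, 0 ≤ x)
    (hlog : Integrable (fun x => Real.log (1 + x)) F) :
    ∀ᵐ t : ℝ, Integrable (logKernel t) F := by
  filter_upwards [ae_integrable_abs_rpow F (p := 1 / 2) (by norm_num) (by norm_num)] with t ht
  have hfun : logKernel t = fun x => Real.log |t - x| := funext (logKernel_eq t)
  rw [hfun]
  refine ((ht.const_mul 2).add ((integrable_const (Real.log (1 + |t|))).add hlog)).mono'
    (by fun_prop : Measurable _).aestronglyMeasurable ?_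
  filter_upwards [hF] with x hx
  simp only [Pi.add_apply, Real.norm_eq_abs]
  have h5 : 0 ≤ Real.log (1 + |t|) := Real.log_nonneg (by linarith [abs_nonneg t])
  have h6 : 0 ≤ Real.log (1 + x) := Real.log_nonneg (by linarith)
  have h7 : 0 ≤ |t - x| ^ (-(1 / 2) : ℝ) := by positivity
  rcases (abs_nonneg (t - x)).eq_or_lt with h0 | h0
  · rw [← h0] at h7 ⊢
    rw [Real.log_zero, abs_zero]; linarith
  · rw [abs_le]
    constructor
    · -- `-log u = 2 log (u ^ (-1/2)) ≤ 2 u ^ (-1/2)`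
      have h1 : Real.log (|t - x| ^ (-(1 / 2) : ℝ)) ≤ |t - x| ^ (-(1 / 2) : ℝ) :=
        Real.log_le_self h7
      rw [Real.log_rpow h0] at h1
      linarith
    · have h2 : |t - x| ≤ (1 + |t|) * (1 + x) := by
        calc |t - x| ≤ |t| + |x| := abs_sub _ _
          _ = |t| + x := by rw [abs_of_nonneg hx]
          _ ≤ _ := by nlinarith [abs_nonneg t]
      have h3 := Real.log_le_log h0 h2
      rw [Real.log_mul (by positivity) (by positivity)] at h3
      linarith

/-! ### Boundary values on the real line -/

lemma ae_measure_singleton_eq_zero (F : Measure ℝ) [IsFiniteMeasure F] :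
    ∀ᵐ t : ℝ, F {t} = 0 := by
  have hc : {t : ℝ | 0 < F {t}}.Countable := Measure.countable_meas_pos_of_disjoint_iUnion
    (fun t => measurableSet_singleton t) fun a b hab => disjoint_singleton.2 hab
  filter_upwards [hc.ae_notMem volume] with t ht
  simpa using ht

lemma norm_mk_le {u ε : ℝ} (hε : 0 ≤ ε) : ‖(⟨u, ε⟩ : ℂ)‖ ≤ |u| + ε := by
  have := Complex.norm_le_abs_re_add_abs_im ⟨u, ε⟩
  simpa [abs_of_nonneg hε] using this

lemma tendsto_mk (u : ℝ) {ε : ℕ → ℝ} (hε : Tendsto ε atTop (𝓝 0)) :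
    Tendsto (fun n => (⟨u, ε n⟩ : ℂ)) atTop (𝓝 (u : ℂ)) := by
  have h1 : Tendsto (fun n => (u : ℂ) + (ε n : ℂ) * Complex.I) atTop
      (𝓝 ((u : ℂ) + ((0 : ℝ) : ℂ) * Complex.I)) :=
    (((Complex.continuous_ofReal.tendsto _).comp hε).mul_const _).const_add _
  simp only [Complex.ofReal_zero, zero_mul, add_zero] at h1
  refine h1.congr fun n => ?_
  apply Complex.ext <;> simp

lemma measurable_mk (t ε : ℝ) : Measurable fun x : ℝ => (⟨x - t, ε⟩ : ℂ) := by
  have h : (fun x : ℝ => (⟨x - t, ε⟩ : ℂ)) =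
      fun x : ℝ => ((x - t : ℝ) : ℂ) + (ε : ℂ) * Complex.I := by
    ext x; apply Complex.ext <;> simp
  rw [h]; fun_prop

lemma tendsto_integral_log_norm {F : Measure ℝ} [IsFiniteMeasure F] {t : ℝ} (h0 : F {t} = 0)
    (hF : ∀ᵐ x ∂F, 0 ≤ x) (hlog : Integrable (fun x => Real.log (1 + x)) F)
    (hint : Integrable (logKernel t) F) {ε : ℕ → ℝ} (hε : ∀ n, ε n ∈ Ioc (0 : ℝ) 1)
    (hlim : Tendsto ε atTop (𝓝 0)) :
    Tendsto (fun n => ∫ x, Real.log ‖(⟨x - t, ε n⟩ : ℂ)‖ ∂F) atTop (𝓝 (Phi F t)) := by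
  have hne : ∀ᵐ x ∂F, x ≠ t := by
    rw [ae_iff]; simpa using h0
  have hbound : Integrable (fun x => |logKernel t x| +
      (Real.log (2 + |t|) + Real.log (1 + x))) F :=
    hint.abs.add ((integrable_const _).add hlog)
  refine tendsto_integral_of_dominated_convergence _ (fun n => ?_) hbound (fun n => ?_) ?_
  · exact (measurable_mk t (ε n)).norm.log.aestronglyMeasurable
  · filter_upwards [hF, hne] with x hx hxt
    have h1 : 0 < |x - t| := abs_pos.2 (sub_ne_zero.2 hxt)
    have h2 : |x - t| ≤ ‖(⟨x - t, ε n⟩ : ℂ)‖ := Complex.abs_re_le_norm ⟨x - t, ε n⟩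
    have h3 : ‖(⟨x - t, ε n⟩ : ℂ)‖ ≤ (2 + |t|) * (1 + x) := by
      refine (norm_mk_le (hε n).1.le).trans ?_
      have := abs_sub x t
      rw [abs_of_nonneg hx] at this
      nlinarith [(hε n).2, abs_nonneg t]
    have h4 := Real.log_le_log h1 h2
    have h5 := Real.log_le_log (h1.trans_le h2) h3
    rw [Real.log_mul (by positivity) (by positivity)] at h5
    rw [logKernel_eq, abs_sub_comm t x, Real.norm_eq_abs, abs_le]
    have h6 : 0 ≤ Real.log (2 + |t|) := Real.log_nonneg (by linarith [abs_nonneg t])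
    have h7 : 0 ≤ Real.log (1 + x) := Real.log_nonneg (by linarith)
    constructor
    · linarith [neg_abs_le (Real.log |x - t|)]
    · linarith [abs_nonneg (Real.log |x - t|)]
  · filter_upwards [hne] with x hxt
    have h1 : 0 < |x - t| := abs_pos.2 (sub_ne_zero.2 hxt)
    rw [logKernel_eq, abs_sub_comm]
    have h2 := (tendsto_mk (x - t) hlim).norm
    rw [Complex.norm_real, Real.norm_eq_abs] at h2
    exact h2.log h1.ne'

/-- The argument of `x - t + iε` tends to `π` for `x < t` and to `0` for `x > t`. -/
lemma tendsto_integral_arg {F : Measure ℝ} [IsProbabilityMeasure F] {t : ℝ} (h0 : F {t} = 0)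
    {ε : ℕ → ℝ} (hε : ∀ n, 0 < ε n) (hlim : Tendsto ε atTop (𝓝 0)) :
    Tendsto (fun n => ∫ x, Complex.arg ⟨x - t, ε n⟩ ∂F) atTop (𝓝 (Real.pi * cdf F t)) := by
  have hne : ∀ᵐ x ∂F, x ≠ t := by
    rw [ae_iff]; simpa using h0
  have hval : ∫ x, (Iic t).indicator (fun _ => Real.pi) x ∂F = Real.pi * cdf F t := by
    rw [integral_indicator measurableSet_Iic, setIntegral_const, cdf_eq_real, smul_eq_mul, mul_comm]
  rw [← hval]
  refine tendsto_integral_of_dominated_convergence (fun _ => Real.pi)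
    (fun n => (measurable_mk t (ε n)).carg.aestronglyMeasurable) (integrable_const _)
    (fun n => ae_of_all _ fun x => Complex.abs_arg_le_pi _) ?_
  filter_upwards [hne] with x hxt
  have h1 := tendsto_mk (x - t) hlim
  rcases lt_or_gt_of_ne hxt with h | h
  · rw [indicator_of_mem (show x ∈ Iic t from h.le)]
    have h2 := Complex.tendsto_arg_nhdsWithin_im_nonneg_of_re_neg_of_im_zero
      (z := ((x - t : ℝ) : ℂ)) (by simpa using h) (by simp)
    exact h2.comp (tendsto_nhdsWithin_iff.2 ⟨h1, Eventually.of_forall fun n => (hε n).le⟩)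
  · rw [indicator_of_notMem (show x ∉ Iic t from not_le.2 h)]
    have h2 : ContinuousAt Complex.arg ((x - t : ℝ) : ℂ) := by
      refine Complex.continuousAt_arg ?_
      rw [Complex.ofReal_mem_slitPlane]; linarith
    have h3 := h2.tendsto.comp h1
    rwa [Complex.arg_ofReal_of_nonneg (by linarith)] at h3

/-- Where `F` puts mass `p < 1` near `t`, Jensen's inequality bounds the modulus of the boundary
values of `exp (-∫ log (w + x) F(dx))` by a Riesz potential of order `p`, uniformly in the height
`ε`. -/
lemma exp_neg_integral_log_le {F : Measure ℝ} [IsProbabilityMeasure F] (hF : ∀ᵐ x ∂F, 0 ≤ x)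
    (hlog : Integrable (fun x => Real.log (1 + x)) F) {A : Set ℝ} (hA : MeasurableSet A)
    {t δ : ℝ} (hδ : 0 < δ) (hAt : ∀ x, x ∉ A → δ ≤ |x - t|) (h0 : F {t} = 0)
    (hint : Integrable (fun x => |t - x| ^ (-F.real A)) F) {ε : ℝ} (hε : 0 < ε) :
    Real.exp (-∫ x, Real.log ‖(⟨x - t, ε⟩ : ℂ)‖ ∂F) ≤
      Real.exp |Real.log δ| * (1 + (F.real A)⁻¹ * ∫ x, |t - x| ^ (-F.real A) ∂F) := by
  set p := F.real A with hp
  have hp0 : 0 ≤ p := measureReal_nonneg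
  set ψ : ℝ → ℝ := fun x => -Real.log ‖(⟨x - t, ε⟩ : ℂ)‖ with hψ
  have hψm : Measurable ψ := (measurable_mk t ε).norm.log.neg
  have hψint : Integrable ψ F := by
    have hw : (⟨-t, ε⟩ : ℂ) ∈ Complex.slitPlane := by
      rw [Complex.mem_slitPlane_iff]; right; exact hε.ne'
    refine ((integrable_clog hF hlog hw).re.neg).congr (ae_of_all _ fun x => ?_)
    have hwx : (⟨-t, ε⟩ : ℂ) + x = ⟨x - t, ε⟩ := by apply Complex.ext <;> simp; ring
    simp only [Pi.neg_apply, hwx, hψ]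
    exact congrArg Neg.neg (Complex.log_re _)
  have hnorm : ∀ x, ε ≤ ‖(⟨x - t, ε⟩ : ℂ)‖ := fun x => by
    have := Complex.abs_im_le_norm ⟨x - t, ε⟩
    simpa [abs_of_pos hε] using this
  have hnorm' : ∀ x, |x - t| ≤ ‖(⟨x - t, ε⟩ : ℂ)‖ := fun x => Complex.abs_re_le_norm ⟨x - t, ε⟩
  have hne : ∀ᵐ x ∂F, x ≠ t := by
    rw [ae_iff]; simpa using h0
  have hI0 : 0 ≤ ∫ x, |t - x| ^ (-p) ∂F := integral_nonneg fun x => by positivity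
  -- the part of the integral away from `t`
  have hfar : ∫ x in Aᶜ, ψ x ∂F ≤ |Real.log δ| := by
    calc ∫ x in Aᶜ, ψ x ∂F ≤ ∫ x in Aᶜ, |Real.log δ| ∂F := by
          refine setIntegral_mono_on hψint.integrableOn (integrable_const _) hA.compl fun x hx => ?_
          have := Real.log_le_log hδ ((hAt x hx).trans (hnorm' x))
          simp only [hψ]
          linarith [neg_abs_le (Real.log δ)]
      _ = F.real Aᶜ * |Real.log δ| := by rw [setIntegral_const, smul_eq_mul]
      _ ≤ 1 * |Real.log δ| := by gcongr; exact measureReal_le_one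
      _ = _ := one_mul _
  -- the part near `t`
  have hnear : Real.exp (∫ x in A, ψ x ∂F) ≤ 1 + p⁻¹ * ∫ x, |t - x| ^ (-p) ∂F := by
    rcases hp0.eq_or_lt with hp' | hp'
    · have hA0 : F.restrict A = 0 := by
        rw [Measure.restrict_eq_zero]
        exact (measureReal_eq_zero_iff).1 hp'.symm
      rw [hA0, ← hp']
      simp
    · have hA0 : F A ≠ 0 := fun h => hp'.ne' (by rw [hp, measureReal_def, h]; rfl)
      have hexp : ∀ x, Real.exp (p * ψ x) = ‖(⟨x - t, ε⟩ : ℂ)‖ ^ (-p) := by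
        intro x
        rw [Real.rpow_def_of_pos (hε.trans_le (hnorm x))]
        congr 1
        simp only [hψ]
        ring
      have hexpint : Integrable (fun x => Real.exp (p * ψ x)) F := by
        refine Integrable.of_bound (hψm.const_mul p).exp.aestronglyMeasurable (ε ^ (-p))
          (ae_of_all _ fun x => ?_)
        rw [Real.norm_of_nonneg (Real.exp_pos _).le, hexp]
        exact Real.rpow_le_rpow_of_nonpos hε (hnorm x) (by linarith)
      have hJ := convexOn_exp.map_set_average_le (μ := F) (t := A) (f := fun x => p * ψ x)
        Real.continuous_exp.continuousOn isClosed_univ hA0 (measure_ne_top _ _)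
        (ae_of_all _ fun _ => mem_univ _) (hψint.const_mul p).integrableOn hexpint.integrableOn
      rw [setAverage_eq, setAverage_eq, integral_const_mul, smul_eq_mul, smul_eq_mul, ← hp,
        inv_mul_cancel_left₀ hp'.ne'] at hJ
      refine hJ.trans ?_
      have h1 : ∫ x in A, Real.exp (p * ψ x) ∂F ≤ ∫ x, |t - x| ^ (-p) ∂F := by
        refine (setIntegral_le_integral hexpint (ae_of_all _ fun x => (Real.exp_pos _).le)).trans ?_
        refine integral_mono_ae hexpint hint ?_
        filter_upwards [hne] with x hx
        rw [hexp, abs_sub_comm]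
        exact Real.rpow_le_rpow_of_nonpos (abs_pos.2 (sub_ne_zero.2 hx)) (hnorm' x) (by linarith)
      have h2 := mul_le_mul_of_nonneg_left h1 (inv_nonneg.2 hp0)
      linarith
  have hsplit : -∫ x, Real.log ‖(⟨x - t, ε⟩ : ℂ)‖ ∂F =
      (∫ x in A, ψ x ∂F) + ∫ x in Aᶜ, ψ x ∂F := by
    rw [integral_add_compl hA hψint, ← integral_neg]
  rw [hsplit, Real.exp_add, mul_comm]
  gcongr

/-! ### The density of the mean of a Dirichlet process of total mass one -/

/-- The Cifarelli–Regazzini density `t ↦ sin (π F(t)) exp (-Φ_F(t)) / π` of the mean of a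
Dirichlet process with parameters `(1, F)`. It vanishes to the left of the support of `F`, where
`F(t) = 0`, so it can be used on the whole line. -/
noncomputable def meanDensity (F : Measure ℝ) (t : ℝ) : ℝ :=
  1 / Real.pi * Real.sin (Real.pi * cdf F t) * Real.exp (-Phi F t)

lemma measurable_Phi (F : Measure ℝ) [IsFiniteMeasure F] : Measurable (Phi F) := by
  have h : Phi F = fun t => ∫ x, Real.log |t - x| ∂F := by
    ext t
    simp only [Phi, logKernel_eq]
  rw [h]
  have hm : Measurable fun q : ℝ × ℝ => Real.log |q.1 - q.2| := by fun_prop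
  exact hm.stronglyMeasurable.integral_prod_right.measurable

lemma measurable_meanDensity (F : Measure ℝ) [IsFiniteMeasure F] : Measurable (meanDensity F) := by
  have h1 : Measurable (cdf F) := (monotone_cdf F).measurable
  have h2 := measurable_Phi F
  unfold meanDensity
  fun_prop

lemma sin_pi_mul_cdf_nonneg (F : Measure ℝ) [IsProbabilityMeasure F] (t : ℝ) :
    0 ≤ Real.sin (Real.pi * cdf F t) :=
  Real.sin_nonneg_of_nonneg_of_le_pi (mul_nonneg Real.pi_pos.le (cdf_nonneg F t))
    (mul_le_of_le_one_right Real.pi_pos.le (cdf_le_one F t))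

lemma meanDensity_nonneg (F : Measure ℝ) [IsProbabilityMeasure F] (t : ℝ) :
    0 ≤ meanDensity F t :=
  mul_nonneg (mul_nonneg (by positivity) (sin_pi_mul_cdf_nonneg F t)) (Real.exp_pos _).le

/-- Smoothing a measure by the Poisson kernel of height `ε` and integrating over `(a, b]`. -/
lemma setIntegral_poisson (m : Measure ℝ) [IsFiniteMeasure m] {a b : ℝ} (hab : a ≤ b) {ε : ℝ}
    (hε : 0 < ε) :
    ∫ t in Ioc a b, ∫ x, ε / ((x - t) ^ 2 + ε ^ 2) ∂m =
      ∫ x, (Real.arctan ((b - x) / ε) - Real.arctan ((a - x) / ε)) ∂m := by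
  have hpos : ∀ x t : ℝ, 0 < (x - t) ^ 2 + ε ^ 2 := fun x t => by positivity
  rw [integral_integral_swap]
  · refine integral_congr_ae (ae_of_all _ fun x => ?_)
    beta_reduce
    rw [← intervalIntegral.integral_of_le hab]
    refine intervalIntegral.integral_eq_sub_of_hasDerivAt
      (f := fun t => Real.arctan ((t - x) / ε)) (fun t _ => ?_) ?_
    · have h1 : HasDerivAt (fun t : ℝ => (t - x) / ε) (1 / ε) t :=
        ((hasDerivAt_id t).sub_const x).div_const ε
      refine h1.arctan.congr_deriv ?_
      have h2 := hpos x t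
      have h3 : 0 < 1 + ((t - x) / ε) ^ 2 := by positivity
      rw [one_div_mul_one_div, div_eq_div_iff (by positivity) h2.ne']
      field_simp
      ring
    · refine Continuous.intervalIntegrable ?_ _ _
      exact continuous_const.div (by fun_prop) fun t => (hpos x t).ne'
  · refine Integrable.of_bound (by fun_prop : Measurable _).aestronglyMeasurable (1 / ε)
      (ae_of_all _ fun q => ?_)
    simp only [Function.uncurry]
    have h1 := hpos q.2 q.1
    rw [Real.norm_of_nonneg (by positivity), div_le_div_iff₀ h1 hε]
    nlinarith [sq_nonneg (q.2 - q.1)]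

lemma sign_cast_mono : Monotone fun u : ℝ => (SignType.sign u : ℝ) := by
  intro u v huv
  beta_reduce
  rcases lt_trichotomy u 0 with hu | hu | hu <;> rcases lt_trichotomy v 0 with hv | hv | hv <;>
    first
    | (exfalso; linarith)
    | simp [hu, hv, sign_pos, sign_neg]

/-- In the limit `ε → 0` the Poisson mass of an interval becomes its indicator, with value one
half at the endpoints. -/
lemma tendsto_arctan_div (u : ℝ) {ε : ℕ → ℝ} (hε : ∀ n, 0 < ε n) (hlim : Tendsto ε atTop (𝓝 0)) :
    Tendsto (fun n => Real.arctan (u / ε n)) atTop (𝓝 (Real.pi / 2 * (SignType.sign u : ℝ))) := by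
  have hinv : Tendsto (fun n => (ε n)⁻¹) atTop atTop :=
    tendsto_inv_nhdsGT_zero.comp (tendsto_nhdsWithin_iff.2 ⟨hlim, Eventually.of_forall hε⟩)
  simp only [div_eq_mul_inv u]
  rcases lt_trichotomy u 0 with h | h | h
  · have h1 := (Real.tendsto_arctan_atBot.mono_right nhdsWithin_le_nhds).comp
      (hinv.const_mul_atTop_of_neg h)
    simpa [sign_neg h, Function.comp_def, neg_div] using h1
  · simp [h]
  · have h1 := (Real.tendsto_arctan_atTop.mono_right nhdsWithin_le_nhds).comp
      (hinv.const_mul_atTop h)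
    simpa [sign_pos h, Function.comp_def] using h1

/-- The Stieltjes inversion formula on a neighbourhood of a point, with both sides evaluated in the
limit by dominated convergence. Endpoints of the interval count with half their mass. -/
lemma exists_local_inversion {m F : Measure ℝ} [IsProbabilityMeasure m]
    [IsProbabilityMeasure F] (hm : ∀ᵐ x ∂m, 0 ≤ x) (hF : ∀ᵐ x ∂F, 0 ≤ x)
    (hlog : Integrable (fun x => Real.log (1 + x)) F)
    (h : ∀ s, 0 ≤ s → ∫ x, (1 + s * x)⁻¹ ∂m = Real.exp (-∫ x, Real.log (1 + s * x) ∂F))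
    (hjump : ∀ x, F {x} < 1) (t₀ : ℝ) :
    ∃ r > 0, IntegrableOn (meanDensity F) (Icc (t₀ - r) (t₀ + r)) ∧
      ∀ a b, t₀ - r ≤ a → a ≤ b → b ≤ t₀ + r →
        ∫ x, (Real.pi / 2 * (SignType.sign (b - x) : ℝ) -
          Real.pi / 2 * (SignType.sign (a - x) : ℝ)) ∂m =
        Real.pi * ∫ t in Ioc a b, meanDensity F t := by
  obtain ⟨δ, hδ, hδF⟩ : ∃ δ > 0, F (Metric.closedBall t₀ δ) < 1 := by
    have h1 := tendsto_measure_cthickening_of_isCompact (μ := F) (isCompact_singleton (x := t₀))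
    have h2 := (h1.mono_left (nhdsWithin_le_nhds (s := Ioi 0))).eventually
      (gt_mem_nhds (hjump t₀))
    obtain ⟨δ, hδ1, hδ2⟩ := (h2.and self_mem_nhdsWithin).exists
    refine ⟨δ, hδ2, ?_⟩
    rwa [← Metric.cthickening_singleton t₀ (le_of_lt hδ2)]
  set A := Metric.closedBall t₀ δ with hA
  set p := F.real A with hp
  have hp0 : 0 ≤ p := measureReal_nonneg
  have hp1 : p < 1 := by
    rw [hp, measureReal_def, ← ENNReal.toReal_one]
    exact (ENNReal.toReal_lt_toReal (measure_ne_top _ _) ENNReal.one_ne_top).2 hδF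
  set r := δ / 2 with hr
  have hr0 : 0 < r := by positivity
  -- the dominating function, from Jensen's inequality
  set D : ℝ → ℝ := fun t => Real.exp |Real.log r| * (1 + p⁻¹ * ∫ x, |t - x| ^ (-p) ∂F) with hD
  have hDint : IntegrableOn D (Icc (t₀ - r) (t₀ + r)) :=
    ((integrable_const 1).add
      ((integrable_prod_abs_rpow F hp0 hp1 _ _).integral_prod_left.const_mul _)).const_mul _
  set ε : ℕ → ℝ := fun n => 1 / ((n : ℝ) + 1) with hε
  have hε0 : ∀ n, 0 < ε n := fun n => Nat.one_div_pos_of_nat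
  have hε1 : ∀ n, ε n ≤ 1 := fun n =>
    (div_le_one (by positivity)).2 (by linarith [(n.cast_nonneg : (0 : ℝ) ≤ n)])
  have hlim : Tendsto ε atTop (𝓝 0) := tendsto_one_div_add_atTop_nhds_zero_nat
  set q : ℕ → ℝ → ℝ := fun n t => ∫ x, ε n / ((x - t) ^ 2 + (ε n) ^ 2) ∂m with hq
  have hqm : ∀ n, Measurable (q n) := by
    intro n
    have hm : Measurable fun z : ℝ × ℝ => ε n / ((z.2 - z.1) ^ 2 + (ε n) ^ 2) := by fun_prop
    exact hm.stronglyMeasurable.integral_prod_right.measurable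
  have hqlim : ∀ᵐ t : ℝ, Tendsto (fun n => q n t) atTop (𝓝 (Real.pi * meanDensity F t)) := by
    filter_upwards [ae_integrable_logKernel hF hlog, ae_measure_singleton_eq_zero F] with t h1 h2
    have h3 := tendsto_integral_log_norm h2 hF hlog h1 (fun n => ⟨hε0 n, hε1 n⟩) hlim
    have h4 := tendsto_integral_arg h2 hε0 hlim
    have h5 := ((Real.continuous_exp.tendsto _).comp h3.neg).mul
      ((Real.continuous_sin.tendsto _).comp h4)
    have h6 : Real.pi * meanDensity F t =
        Real.exp (-Phi F t) * Real.sin (Real.pi * cdf F t) := by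
      rw [meanDensity]
      field_simp
    rw [h6]
    refine h5.congr fun n => ?_
    exact (integral_poisson_eq hm hF hlog h t (hε0 n)).symm
  have hqD : ∀ᵐ t : ℝ, t ∈ Icc (t₀ - r) (t₀ + r) → ∀ n, ‖q n t‖ ≤ D t := by
    filter_upwards [ae_integrable_abs_rpow F hp0 hp1, ae_measure_singleton_eq_zero F]
      with t h1 h2 ht n
    have hAt : ∀ x, x ∉ A → r ≤ |x - t| := by
      intro x hx
      rw [hA, Metric.mem_closedBall, Real.dist_eq, not_le] at hx
      have h3 : |t - t₀| ≤ r := abs_le.2 ⟨by linarith [ht.1], by linarith [ht.2]⟩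
      have h4 : |x - t₀| ≤ |x - t| + |t - t₀| := abs_sub_le _ _ _
      linarith
    have h5 := exp_neg_integral_log_le hF hlog measurableSet_closedBall hr0 hAt h2 h1 (hε0 n)
    simp only [hq]
    rw [integral_poisson_eq hm hF hlog h t (hε0 n), norm_mul,
      Real.norm_of_nonneg (Real.exp_pos _).le]
    refine le_trans ?_ h5
    exact mul_le_of_le_one_right (Real.exp_pos _).le (Real.abs_sin_le_one _)
  refine ⟨r, hr0, ?_, fun a b ha hab hb => ?_⟩
  · refine (hDint.const_mul (1 / Real.pi)).mono' (measurable_meanDensity F).aestronglyMeasurable ?_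
    rw [ae_restrict_iff' measurableSet_Icc]
    filter_upwards [hqlim, hqD] with t h1 h2 ht
    have h3 := le_of_tendsto h1.norm (Eventually.of_forall (h2 ht))
    rw [norm_mul, Real.norm_of_nonneg Real.pi_pos.le] at h3
    rw [div_mul_eq_mul_div, one_mul, le_div_iff₀ Real.pi_pos]
    linarith
  · have hsub : Ioc a b ⊆ Icc (t₀ - r) (t₀ + r) := fun t ht =>
      ⟨ha.trans ht.1.le, ht.2.trans hb⟩
    have hleft : Tendsto (fun n => ∫ t in Ioc a b, q n t) atTop
        (𝓝 (∫ t in Ioc a b, Real.pi * meanDensity F t)) := by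
      refine tendsto_integral_of_dominated_convergence D
        (fun n => (hqm n).aestronglyMeasurable) (hDint.mono_set hsub) (fun n => ?_)
        (ae_restrict_of_ae hqlim)
      rw [ae_restrict_iff' measurableSet_Ioc]
      filter_upwards [hqD] with t h2 ht
      exact h2 (hsub ht) n
    have hright : Tendsto
        (fun n => ∫ x, (Real.arctan ((b - x) / ε n) - Real.arctan ((a - x) / ε n)) ∂m) atTop
        (𝓝 (∫ x, (Real.pi / 2 * (SignType.sign (b - x) : ℝ) -
          Real.pi / 2 * (SignType.sign (a - x) : ℝ)) ∂m)) := by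
      refine tendsto_integral_of_dominated_convergence (fun _ => Real.pi)
        (fun n => (by fun_prop : Measurable _).aestronglyMeasurable) (integrable_const _)
        (fun n => ae_of_all _ fun x => ?_) (ae_of_all _ fun x => ?_)
      · rw [Real.norm_eq_abs, abs_le]
        have h1 := Real.arctan_lt_pi_div_two ((b - x) / ε n)
        have h2 := Real.neg_pi_div_two_lt_arctan ((b - x) / ε n)
        have h3 := Real.arctan_lt_pi_div_two ((a - x) / ε n)
        have h4 := Real.neg_pi_div_two_lt_arctan ((a - x) / ε n)
        constructor <;> linarith
      · exact (tendsto_arctan_div _ hε0 hlim).sub (tendsto_arctan_div _ hε0 hlim)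
    rw [← integral_const_mul]
    refine tendsto_nhds_unique hright (hleft.congr fun n => ?_)
    exact setIntegral_poisson m hab (hε0 n)

/-- A law on `[0, ∞)` whose Stieltjes transform satisfies the Markov–Krein identity with
`θ = 1` for a nondegenerate `F` is absolutely continuous with the Cifarelli–Regazzini density. -/
lemma eq_withDensity_meanDensity {m F : Measure ℝ} [IsProbabilityMeasure m]
    [IsProbabilityMeasure F] (hm : ∀ᵐ x ∂m, 0 ≤ x) (hF : ∀ᵐ x ∂F, 0 ≤ x)
    (hlog : Integrable (fun x => Real.log (1 + x)) F)
    (h : ∀ s, 0 ≤ s → ∫ x, (1 + s * x)⁻¹ ∂m = Real.exp (-∫ x, Real.log (1 + s * x) ∂F))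
    (hjump : ∀ x, F {x} < 1) :
    m = volume.withDensity fun t => ENNReal.ofReal (meanDensity F t) := by
  choose r hr0 hrint hinv using exists_local_inversion hm hF hlog h hjump
  set ν : Measure ℝ := volume.withDensity fun t => ENNReal.ofReal (meanDensity F t) with hν
  have hνJ : ∀ t₀ s, MeasurableSet s → s ⊆ Icc (t₀ - r t₀) (t₀ + r t₀) →
      ν s = ENNReal.ofReal (∫ t in s, meanDensity F t) := by
    intro t₀ s hs hsub
    rw [hν, withDensity_apply _ hs, ofReal_integral_eq_lintegral_ofReal
      ((hrint t₀).mono_set hsub) (ae_of_all _ (meanDensity_nonneg F))]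
  have hsign : ∀ a b x : ℝ, a ≤ b → (Ioo a b).indicator (fun _ => Real.pi) x ≤
      Real.pi / 2 * (SignType.sign (b - x) : ℝ) - Real.pi / 2 * (SignType.sign (a - x) : ℝ) := by
    intro a b x hab
    by_cases hx : x ∈ Ioo a b
    · rw [indicator_of_mem hx, sign_pos (by linarith [hx.2]), sign_neg (by linarith [hx.1])]
      simp
    · rw [indicator_of_notMem hx, ← mul_sub]
      refine mul_nonneg (by positivity) (sub_nonneg.2 ?_)
      exact sign_cast_mono (by linarith : a - x ≤ b - x)
  have hsignint : ∀ a b : ℝ, Integrable (fun x => Real.pi / 2 * (SignType.sign (b - x) : ℝ) -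
      Real.pi / 2 * (SignType.sign (a - x) : ℝ)) m := by
    have h1 : ∀ a : ℝ, Integrable (fun x => Real.pi / 2 * (SignType.sign (a - x) : ℝ)) m := by
      intro a
      refine Integrable.const_mul (Integrable.of_bound ?_ 1 (ae_of_all _ fun x => ?_)) _
      · have hmon : Antitone fun x : ℝ => (SignType.sign (a - x) : ℝ) := fun x y hxy =>
          sign_cast_mono (by linarith : a - y ≤ a - x)
        exact hmon.measurable.aestronglyMeasurable
      · rcases lt_trichotomy (a - x) 0 with h | h | h
        · simp [sign_neg h]
        · simp [h]
        · simp [sign_pos h]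
    exact fun a b => (h1 b).sub (h1 a)
  -- `m {t₀} ≤ ν [t₀ - s, t₀ + s]` for small `s`, and `ν` has no atoms.
  have hatom : ∀ t₀, m {t₀} = 0 := by
    intro t₀
    have hJ : ν (Icc (t₀ - r t₀) (t₀ + r t₀)) ≠ ∞ := by
      rw [hνJ t₀ _ measurableSet_Icc subset_rfl]; exact ENNReal.ofReal_ne_top
    have h1 : Tendsto (fun s => ν (Metric.cthickening s {t₀})) (𝓝 0) (𝓝 (ν {t₀})) := by
      refine tendsto_measure_cthickening_of_isClosed ⟨r t₀, hr0 t₀, ?_⟩ isClosed_singleton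
      rwa [Metric.cthickening_singleton t₀ (hr0 t₀).le, Real.closedBall_eq_Icc]
    have h2 : ν {t₀} = 0 := withDensity_absolutelyContinuous _ _ (measure_singleton t₀)
    rw [h2] at h1
    refine le_antisymm (ge_of_tendsto (h1.mono_left (nhdsWithin_le_nhds (s := Ioi 0))) ?_) bot_le
    filter_upwards [Ioc_mem_nhdsGT (hr0 t₀)] with s hs
    have hs0 : 0 < s := hs.1
    have hs1 : s ≤ r t₀ := hs.2
    rw [Metric.cthickening_singleton t₀ hs0.le, Real.closedBall_eq_Icc]
    have h3 := hinv t₀ (t₀ - s) (t₀ + s) (by linarith) (by linarith) (by linarith)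
    have h4 : Real.pi * m.real (Ioo (t₀ - s) (t₀ + s)) ≤
        Real.pi * ∫ t in Ioc (t₀ - s) (t₀ + s), meanDensity F t := by
      rw [← h3]
      refine le_trans (le_of_eq ?_) (integral_mono
        ((integrable_const Real.pi).indicator measurableSet_Ioo) (hsignint _ _)
        fun x => hsign _ _ x (by linarith))
      rw [integral_indicator measurableSet_Ioo, setIntegral_const, smul_eq_mul, mul_comm]
    calc m {t₀} ≤ m (Ioo (t₀ - s) (t₀ + s)) :=
          measure_mono (singleton_subset_iff.2 ⟨by linarith, by linarith⟩)
      _ = ENNReal.ofReal (m.real (Ioo (t₀ - s) (t₀ + s))) :=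
          (ofReal_measureReal (measure_ne_top _ _)).symm
      _ ≤ ENNReal.ofReal (∫ t in Ioc (t₀ - s) (t₀ + s), meanDensity F t) :=
          ENNReal.ofReal_le_ofReal (le_of_mul_le_mul_left h4 Real.pi_pos)
      _ = ν (Ioc (t₀ - s) (t₀ + s)) := (hνJ t₀ _ measurableSet_Ioc fun t ht =>
          ⟨by linarith [ht.1], by linarith [ht.2]⟩).symm
      _ ≤ ν (Icc (t₀ - s) (t₀ + s)) := measure_mono Ioc_subset_Icc_self
  have hIoc : ∀ t₀ a b, t₀ - r t₀ ≤ a → a ≤ b → b ≤ t₀ + r t₀ → m (Ioc a b) = ν (Ioc a b) := by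
    intro t₀ a b ha hab hb
    have hne : ∀ c : ℝ, ∀ᵐ x ∂m, x ≠ c := fun c => by
      rw [ae_iff]; simpa using hatom c
    have h3 := hinv t₀ a b ha hab hb
    have h4 : ∫ x, (Real.pi / 2 * (SignType.sign (b - x) : ℝ) -
        Real.pi / 2 * (SignType.sign (a - x) : ℝ)) ∂m = Real.pi * m.real (Ioc a b) := by
      rw [mul_comm, ← smul_eq_mul, ← setIntegral_const, ← integral_indicator measurableSet_Ioc]
      refine integral_congr_ae ?_
      filter_upwards [hne a, hne b] with x hxa hxb
      rcases lt_or_gt_of_ne hxa with h1 | h1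
      · rw [indicator_of_notMem (fun hx : x ∈ Ioc a b => (hx.1.trans h1).false),
          sign_pos (by linarith), sign_pos (by linarith), sub_self]
      · rcases lt_or_gt_of_ne hxb with h2 | h2
        · rw [indicator_of_mem (show x ∈ Ioc a b from ⟨h1, h2.le⟩),
            sign_pos (by linarith), sign_neg (by linarith)]
          simp
        · rw [indicator_of_notMem (fun hx : x ∈ Ioc a b => (h2.trans_le hx.2).false),
            sign_neg (by linarith), sign_neg (by linarith), sub_self]
    rw [h4] at h3
    rw [hνJ t₀ _ measurableSet_Ioc fun t ht => ⟨ha.trans ht.1.le, ht.2.trans hb⟩,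
      ← mul_left_cancel₀ Real.pi_pos.ne' h3, ofReal_measureReal (measure_ne_top _ _)]
  obtain ⟨S, hS, hcover⟩ := TopologicalSpace.countable_cover_nhds
    (f := fun t₀ : ℝ => Ioc (t₀ - r t₀) (t₀ + r t₀))
    fun t₀ => Ioc_mem_nhds (by linarith [hr0 t₀]) (by linarith [hr0 t₀])
  refine Measure.ext_of_biUnion_eq_univ hS hcover fun t₀ _ => ?_
  refine Measure.ext_of_Ioc _ _ fun a b _ => ?_
  rw [Measure.restrict_apply measurableSet_Ioc, Measure.restrict_apply measurableSet_Ioc,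
    Ioc_inter_Ioc]
  rcases le_total (a ⊔ (t₀ - r t₀)) (b ⊓ (t₀ + r t₀)) with hle | hle
  · exact hIoc t₀ _ _ le_sup_right hle inf_le_right
  · rw [Ioc_eq_empty (not_lt.2 hle), measure_empty, measure_empty]

/-! ### Beta laws and products of independent variables -/

lemma isProbabilityMeasure_betaLaw {σ : ℝ} (hσ0 : 0 < σ) (hσ1 : σ ≤ 1) :
    IsProbabilityMeasure (betaLaw σ (1 - σ)) := by
  unfold betaLaw
  split_ifs with h
  · infer_instance
  · exact isProbabilityMeasureBeta hσ0 (lt_of_le_of_ne (by linarith) (Ne.symm h))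

lemma ae_betaLaw_nonneg (a b : ℝ) : ∀ᵐ x ∂betaLaw a b, 0 ≤ x := by
  unfold betaLaw
  split_ifs with h
  · exact (ae_dirac_iff (p := fun x : ℝ => 0 ≤ x) measurableSet_Ici).2 zero_le_one
  · rw [betaMeasure, ae_withDensity_iff (f := betaPDF a b)
      (measurable_betaPDFReal a b).ennreal_ofReal]
    refine ae_of_all _ fun x hx => ?_
    by_contra hneg
    exact hx (betaPDF_eq_zero_of_nonpos (not_le.1 hneg).le)

/-- The Stieltjes transform of a beta law with parameters `(σ, 1 - σ)`. The substitution
`b = u / (1 + c - c u)` of the unit interval turns the integrand into the beta density. -/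
lemma integral_betaLaw {σ : ℝ} (hσ0 : 0 < σ) (hσ1 : σ ≤ 1) {c : ℝ} (hc : 0 ≤ c) :
    ∫ b, (1 + c * b)⁻¹ ∂betaLaw σ (1 - σ) = (1 + c) ^ (-σ) := by
  rcases hσ1.eq_or_lt with rfl | hσ1
  · simp [betaLaw, Real.rpow_neg_one]
  have hσ' : 0 < 1 - σ := by linarith
  have hbeta : betaLaw σ (1 - σ) = betaMeasure σ (1 - σ) := by
    rw [betaLaw, if_neg hσ'.ne']
  have hpdf : Measurable (betaPDF σ (1 - σ)) := (measurable_betaPDFReal _ _).ennreal_ofReal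
  have hind : ∀ g : ℝ → ℝ≥0∞, ∫⁻ x, betaPDF σ (1 - σ) x * g x =
      ∫⁻ x in Ioo 0 1, betaPDF σ (1 - σ) x * g x := by
    intro g
    rw [← lintegral_indicator measurableSet_Ioo]
    refine lintegral_congr fun x => ?_
    by_cases hx : x ∈ Ioo (0 : ℝ) 1
    · rw [indicator_of_mem hx]
    · rw [indicator_of_notMem hx]
      have : betaPDF σ (1 - σ) x = 0 := by
        rw [mem_Ioo, not_and_or, not_lt, not_lt] at hx
        exact hx.elim betaPDF_eq_zero_of_nonpos betaPDF_eq_zero_of_one_le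
      rw [this, zero_mul]
  have hd : ∀ u ∈ Ioo (0 : ℝ) 1, 0 < 1 + c - c * u := fun u hu => by nlinarith [hu.1, hu.2]
  have himage : (fun u => u / (1 + c - c * u)) '' Ioo 0 1 = Ioo (0 : ℝ) 1 := by
    ext b
    constructor
    · rintro ⟨u, hu, rfl⟩
      refine ⟨div_pos hu.1 (hd u hu), (div_lt_one (hd u hu)).2 ?_⟩
      nlinarith [hu.1, hu.2]
    · intro hb
      have h1 : 0 < 1 + c * b := by nlinarith [hb.1]
      refine ⟨b * (1 + c) / (1 + c * b), ⟨?_, ?_⟩, ?_⟩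
      · exact div_pos (mul_pos hb.1 (by linarith)) h1
      · rw [div_lt_one h1]; nlinarith [hb.2]
      · beta_reduce
        have h2 : 1 + c - c * (b * (1 + c) / (1 + c * b)) = (1 + c) / (1 + c * b) := by
          field_simp
          ring
        rw [h2, div_div_div_cancel_right₀ h1.ne', mul_div_cancel_right₀ _ (by linarith)]
  have hinj : InjOn (fun u => u / (1 + c - c * u)) (Ioo (0 : ℝ) 1) := by
    intro u hu v hv huv
    beta_reduce at huv
    rw [div_eq_div_iff (hd u hu).ne' (hd v hv).ne'] at huv
    have h1 : (1 + c) * (u - v) = 0 := by linear_combination huv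
    rcases mul_eq_zero.1 h1 with h2 | h2 <;> linarith
  have hderiv : ∀ u ∈ Ioo (0 : ℝ) 1, HasDerivWithinAt (fun u => u / (1 + c - c * u))
      ((1 + c) / (1 + c - c * u) ^ 2) (Ioo 0 1) u := by
    intro u hu
    have h1 : HasDerivAt (fun u => 1 + c - c * u) (-(c * 1)) u :=
      ((hasDerivAt_id u).const_mul c).const_sub (1 + c)
    have h2 := (hasDerivAt_id u).div h1 (hd u hu).ne'
    refine (h2.congr_deriv ?_).hasDerivWithinAt
    simp only [id]
    ring
  have hcv := lintegral_image_eq_lintegral_abs_deriv_mul measurableSet_Ioo hderiv hinj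
    fun b => betaPDF σ (1 - σ) b * ENNReal.ofReal (1 + c * b)⁻¹
  rw [himage] at hcv
  have hnonneg : 0 ≤ᵐ[betaLaw σ (1 - σ)] fun b => (1 + c * b)⁻¹ := by
    filter_upwards [ae_betaLaw_nonneg σ (1 - σ)] with b hb
    have : 0 ≤ c * b := mul_nonneg hc hb
    exact inv_nonneg.2 (by linarith)
  rw [integral_eq_lintegral_of_nonneg_ae hnonneg (by fun_prop : Measurable _).aestronglyMeasurable,
    hbeta, betaMeasure, lintegral_withDensity_eq_lintegral_mul _ hpdf (by fun_prop)]
  simp only [Pi.mul_apply]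
  rw [hind, hcv]
  have hpoint : ∀ u ∈ Ioo (0 : ℝ) 1, ENNReal.ofReal |(1 + c) / (1 + c - c * u) ^ 2| *
      (betaPDF σ (1 - σ) (u / (1 + c - c * u)) *
        ENNReal.ofReal (1 + c * (u / (1 + c - c * u)))⁻¹) =
      betaPDF σ (1 - σ) u * ENNReal.ofReal ((1 + c) ^ (-σ)) := by
    intro u hu
    set d := 1 + c - c * u with hdd
    have hd0 : 0 < d := hd u hu
    have hu0 := hu.1
    have hu1 : 0 < 1 - u := by linarith [hu.2]
    have hc1 : 0 < 1 + c := by linarith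
    have hB := beta_pos hσ0 hσ'
    have hmem : u / d ∈ Ioo (0 : ℝ) 1 := himage ▸ mem_image_of_mem _ hu
    have e1 : 1 + c * (u / d) = (1 + c) / d := by
      rw [eq_div_iff hd0.ne']
      linear_combination c * div_mul_cancel₀ u hd0.ne' + hdd
    have e2 : 1 - u / d = (1 + c) * (1 - u) / d := by
      rw [eq_div_iff hd0.ne']
      linear_combination hdd - div_mul_cancel₀ u hd0.ne'
    rw [betaPDF_of_pos_lt_one hmem.1 hmem.2, betaPDF_of_pos_lt_one hu.1 hu.2, e1, e2,
      abs_of_pos (by positivity), ← ENNReal.ofReal_mul (by positivity),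
      ← ENNReal.ofReal_mul (by positivity), ← ENNReal.ofReal_mul (by positivity)]
    congr 1
    rw [Real.div_rpow hu0.le hd0.le, Real.div_rpow (by positivity) hd0.le,
      Real.mul_rpow hc1.le hu1.le]
    have e3 : d ^ (σ - 1) * d ^ (-σ) = d⁻¹ := by
      rw [← Real.rpow_add hd0, ← Real.rpow_neg_one]; congr 1; ring
    rw [show (1 - σ - 1 : ℝ) = -σ by ring]
    have e5 : d ^ (-σ) ≠ 0 := (Real.rpow_pos_of_pos hd0 _).ne'
    have e6 : d ^ (σ - 1) ≠ 0 := (Real.rpow_pos_of_pos hd0 _).ne'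
    have e7 : d * (d ^ (σ - 1) * d ^ (-σ)) = 1 := by rw [e3]; field_simp
    field_simp
    linear_combination (-1 : ℝ) * e7
  rw [setLIntegral_congr_fun measurableSet_Ioo hpoint, ← hind, lintegral_mul_const _ hpdf,
    lintegral_betaPDF_eq_one hσ0 hσ', one_mul, ENNReal.toReal_ofReal (by positivity)]

/-- A product of independent factors has as law the image of the product of their laws. -/
lemma hasLaw_mul_of_indepFun {Ω : Type*} [MeasurableSpace Ω] {μ : Measure Ω}
    [IsProbabilityMeasure μ] {U V : Ω → ℝ} {α β : Measure ℝ} (hU : HasLaw U α μ)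
    (hV : HasLaw V β μ) (hUV : IndepFun U V μ) :
    HasLaw (fun ω => U ω * V ω) ((α.prod β).map fun q => q.1 * q.2) μ where
  aemeasurable := hU.aemeasurable.mul hV.aemeasurable
  map_eq := by
    rw [← hU.map_eq, ← hV.map_eq,
      ← (indepFun_iff_map_prod_eq_prod_map_map hU.aemeasurable hV.aemeasurable).1 hUV,
      AEMeasurable.map_map_of_aemeasurable (by fun_prop)
        (hU.aemeasurable.prodMk hV.aemeasurable)]
    rfl

lemma ae_prod_mul_nonneg {α β : Measure ℝ} [IsProbabilityMeasure α] [IsProbabilityMeasure β]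
    (hα : ∀ᵐ x ∂α, 0 ≤ x) (hβ : ∀ᵐ x ∂β, 0 ≤ x) : ∀ᵐ q ∂α.prod β, 0 ≤ q.1 * q.2 := by
  filter_upwards [Measure.quasiMeasurePreserving_fst.ae hα,
    Measure.quasiMeasurePreserving_snd.ae hβ] with q h1 h2
  exact mul_nonneg h1 h2

lemma ae_map_mul_nonneg {α β : Measure ℝ} [IsProbabilityMeasure α] [IsProbabilityMeasure β]
    (hα : ∀ᵐ x ∂α, 0 ≤ x) (hβ : ∀ᵐ x ∂β, 0 ≤ x) :
    ∀ᵐ x ∂(α.prod β).map fun q => q.1 * q.2, 0 ≤ x :=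
  (ae_map_iff (p := fun x : ℝ => 0 ≤ x) (by fun_prop) measurableSet_Ici).2
    (ae_prod_mul_nonneg hα hβ)

/-- Multiplication by an independent gamma variable turns the generalised Stieltjes transform
of order `θ` into a Laplace transform. -/
lemma integral_exp_gamma_mul {θ : ℝ} (hθ : 0 ≤ θ) {β : Measure ℝ} [IsProbabilityMeasure β]
    (hβ : ∀ᵐ x ∂β, 0 ≤ x) {s : ℝ} (hs : 0 ≤ s) :
    ∫ x, Real.exp (-(s * x)) ∂((gammaLaw θ).prod β).map (fun q => q.1 * q.2) =
      ∫ x, (1 + s * x) ^ (-θ) ∂β := by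
  have := isProbabilityMeasure_gammaLaw hθ
  rw [integral_map (by fun_prop) (by fun_prop : Measurable _).aestronglyMeasurable,
    integral_prod_symm]
  · refine integral_congr_ae ?_
    filter_upwards [hβ] with x hx
    rw [← integral_exp_gammaLaw hθ (mul_nonneg hs hx)]
    refine integral_congr_ae (ae_of_all _ fun g => ?_)
    beta_reduce
    congr 1
    ring
  · refine Integrable.of_bound (by fun_prop : Measurable _).aestronglyMeasurable 1 ?_
    filter_upwards [ae_prod_mul_nonneg (ae_gammaLaw_nonneg hθ) hβ] with q hq
    rw [Real.norm_of_nonneg (Real.exp_pos _).le, Real.exp_le_one_iff, neg_nonpos]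
    exact mul_nonneg hs hq

/-- Multiplication by an independent beta`(σ, 1 - σ)` variable turns the generalised Stieltjes
transform of order `σ` into the Stieltjes transform of order one. -/
lemma integral_inv_beta_mul {σ : ℝ} (hσ0 : 0 < σ) (hσ1 : σ ≤ 1) {β : Measure ℝ}
    [IsProbabilityMeasure β] (hβ : ∀ᵐ x ∂β, 0 ≤ x) {s : ℝ} (hs : 0 ≤ s) :
    ∫ x, (1 + s * x)⁻¹ ∂((betaLaw σ (1 - σ)).prod β).map (fun q => q.1 * q.2) =
      ∫ x, (1 + s * x) ^ (-σ) ∂β := by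
  have := isProbabilityMeasure_betaLaw hσ0 hσ1
  rw [integral_map (by fun_prop) (by fun_prop : Measurable _).aestronglyMeasurable,
    integral_prod_symm]
  · refine integral_congr_ae ?_
    filter_upwards [hβ] with x hx
    rw [← integral_betaLaw hσ0 hσ1 (mul_nonneg hs hx)]
    refine integral_congr_ae (ae_of_all _ fun g => ?_)
    beta_reduce
    congr 2
    ring
  · refine Integrable.of_bound (by fun_prop : Measurable _).aestronglyMeasurable 1 ?_
    filter_upwards [ae_prod_mul_nonneg (ae_betaLaw_nonneg σ (1 - σ)) hβ] with q hq
    have : 0 ≤ s * (q.1 * q.2) := mul_nonneg hs hq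
    rw [Real.norm_of_nonneg (by positivity)]
    exact inv_le_one_of_one_le₀ (by linarith)

/-! ### The law of the thinned variable -/

/-- The law of `X Y` for an independent Bernoulli variable `Y`: with probability `1 - σ` it is an
atom at the origin. -/
lemma law_mul_bernoulli {Ω : Type*} [MeasurableSpace Ω] {μ : Measure Ω} [IsProbabilityMeasure μ]
    {X Y : Ω → ℝ} {FX FXY : Measure ℝ} {σ : ℝ} (hσ0 : 0 < σ) (hσ1 : σ ≤ 1) (hX : HasLaw X FX μ)
    (hY : HasLaw Y (bernoulliMeasure (1 : ℝ) 0 ⟨σ, hσ0.le, hσ1⟩) μ) (hXYindep : IndepFun X Y μ)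
    (hXY : HasLaw (fun ω => X ω * Y ω) FXY μ) :
    FXY = ENNReal.ofReal σ • FX + ENNReal.ofReal (1 - σ) • Measure.dirac 0 := by
  have hFX : IsProbabilityMeasure FX := hX.isProbabilityMeasure_iff.1 inferInstance
  have h := hasLaw_mul_of_indepFun hX hY hXYindep
  rw [← hXY.map_eq, h.map_eq, bernoulliMeasure_def]
  ext s hs
  have hm : Measurable fun q : ℝ × ℝ => q.1 * q.2 := by fun_prop
  rw [Measure.map_apply hm hs, Measure.prod_add, Measure.add_apply]
  have hsmul : ∀ (c : ℝ≥0) (y : ℝ), FX.prod (c • Measure.dirac y)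
      ((fun q : ℝ × ℝ => q.1 * q.2) ⁻¹' s) = c * FX ((fun x => x * y) ⁻¹' s) := by
    intro c y
    have h1 : FX.prod (c • Measure.dirac y) = c • FX.prod (Measure.dirac y) :=
      Measure.prod_smul_right (c : ℝ≥0∞)
    rw [h1, Measure.prod_dirac, Measure.smul_apply, Measure.map_apply (by fun_prop) (hm hs)]
    rfl
  have h0 : FX ((fun x => x * 0) ⁻¹' s) = Measure.dirac (0 : ℝ) s := by
    rw [Measure.dirac_apply' _ hs]
    by_cases h0 : (0 : ℝ) ∈ s <;> simp [h0]
  rw [hsmul, hsmul, h0]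
  simp only [mul_one, preimage_id', Measure.add_apply, Measure.smul_apply, smul_eq_mul]
  have h1 : ((unitInterval.toNNReal ⟨σ, hσ0.le, hσ1⟩ : ℝ≥0) : ℝ≥0∞) = ENNReal.ofReal σ := by
    rw [ENNReal.ofReal, ENNReal.coe_inj]
    exact (Real.toNNReal_of_nonneg hσ0.le).symm
  have h2 : ((unitInterval.toNNReal (unitInterval.symm ⟨σ, hσ0.le, hσ1⟩) : ℝ≥0) : ℝ≥0∞) =
      ENNReal.ofReal (1 - σ) := by
    rw [ENNReal.ofReal, ENNReal.coe_inj]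
    exact (Real.toNNReal_of_nonneg (sub_nonneg.2 hσ1)).symm
  rw [h1, h2]

/-- Integration against the thinned law. -/
lemma integral_thinned {F : Measure ℝ} {σ : ℝ} (hσ0 : 0 ≤ σ) (hσ1 : σ ≤ 1) {f : ℝ → ℝ}
    (hf : Integrable f F) :
    Integrable f (ENNReal.ofReal σ • F + ENNReal.ofReal (1 - σ) • Measure.dirac 0) ∧
      ∫ x, f x ∂(ENNReal.ofReal σ • F + ENNReal.ofReal (1 - σ) • Measure.dirac 0) =
        σ * ∫ x, f x ∂F + (1 - σ) * f 0 := by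
  have h1 : Integrable f (ENNReal.ofReal σ • F) := hf.smul_measure ENNReal.ofReal_ne_top
  have h2 : Integrable f (ENNReal.ofReal (1 - σ) • Measure.dirac 0) :=
    (integrable_dirac (by simp)).smul_measure ENNReal.ofReal_ne_top
  refine ⟨h1.add_measure h2, ?_⟩
  rw [integral_add_measure h1 h2, integral_smul_measure, integral_smul_measure, integral_dirac,
    ENNReal.toReal_ofReal hσ0, ENNReal.toReal_ofReal (by linarith), smul_eq_mul, smul_eq_mul]

lemma cdf_thinned {F G : Measure ℝ} [IsProbabilityMeasure F] [IsProbabilityMeasure G] {σ : ℝ}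
    (hσ0 : 0 ≤ σ) (hσ1 : σ ≤ 1)
    (hG : G = ENNReal.ofReal σ • F + ENNReal.ofReal (1 - σ) • Measure.dirac 0) {x : ℝ}
    (hx : 0 ≤ x) : cdf G x = σ * cdf F x + (1 - σ) := by
  have hdirac : Measure.dirac (0 : ℝ) (Iic x) = 1 := by
    rw [Measure.dirac_apply' _ measurableSet_Iic, indicator_of_mem (by exact hx), Pi.one_apply]
  rw [cdf_eq_real, cdf_eq_real, measureReal_def, hG, Measure.add_apply, Measure.smul_apply,
    Measure.smul_apply, hdirac, smul_eq_mul, smul_eq_mul, mul_one,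
    ENNReal.toReal_add (ENNReal.mul_ne_top ENNReal.ofReal_ne_top (measure_ne_top _ _))
      ENNReal.ofReal_ne_top, ENNReal.toReal_mul, ENNReal.toReal_ofReal hσ0,
    ENNReal.toReal_ofReal (by linarith), measureReal_def]

lemma sin_pi_mul_cdf_thinned {F G : Measure ℝ} [IsProbabilityMeasure F] [IsProbabilityMeasure G]
    {σ : ℝ} (hσ0 : 0 ≤ σ) (hσ1 : σ ≤ 1)
    (hG : G = ENNReal.ofReal σ • F + ENNReal.ofReal (1 - σ) • Measure.dirac 0) {x : ℝ}
    (hx : 0 < x) : Real.sin (Real.pi * cdf G x) =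
      if 0 < cdf F x then Real.sin (Real.pi * σ * (1 - cdf F x))
      else Real.sin (Real.pi * (1 - σ)) := by
  rw [cdf_thinned hσ0 hσ1 hG hx.le]
  split_ifs with h
  · rw [← Real.sin_pi_sub]
    congr 1
    ring
  · have h0 : cdf F x = 0 := le_antisymm (not_lt.1 h) (cdf_nonneg F x)
    rw [h0]
    congr 1
    ring

/-- The contribution `x ^ (σ - 1)` in `ξ` is that of the atom of the thinned law at the origin. -/
lemma meanDensity_thinned {F G : Measure ℝ} {σ : ℝ}
    (hσ0 : 0 ≤ σ) (hσ1 : σ ≤ 1)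
    (hG : G = ENNReal.ofReal σ • F + ENNReal.ofReal (1 - σ) • Measure.dirac 0) {x : ℝ}
    (hx : 0 < x) (hint : Integrable (logKernel x) F) : meanDensity G x = xiDensity σ F G x := by
  have hPhi : Phi G x = σ * Phi F x + (1 - σ) * Real.log x := by
    have := (integral_thinned hσ0 hσ1 hint).2
    rw [← hG, logKernel_eq, sub_zero, abs_of_pos hx] at this
    exact this
  rw [meanDensity, xiDensity, hPhi, Real.rpow_def_of_pos hx]
  have : Real.exp (-(σ * Phi F x + (1 - σ) * Real.log x)) =
      Real.exp (Real.log x * (σ - 1)) * Real.exp (-σ * Phi F x) := by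
    rw [← Real.exp_add]
    congr 1
    ring
  rw [this]
  ring

/-- The Cifarelli–Regazzini law of a thinned measure on `[0, ∞)`, in the form with density `ξ`. -/
lemma withDensity_meanDensity_eq_lawOfDensity {F G : Measure ℝ} [IsProbabilityMeasure F]
    [IsProbabilityMeasure G] {σ : ℝ} (hσ0 : 0 ≤ σ) (hσ1 : σ ≤ 1)
    (hG : G = ENNReal.ofReal σ • F + ENNReal.ofReal (1 - σ) • Measure.dirac 0)
    (hG0 : ∀ᵐ x ∂G, 0 ≤ x) (hint : ∀ᵐ t : ℝ, Integrable (logKernel t) F) :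
    (volume.withDensity fun t => ENNReal.ofReal (meanDensity G t)) =
      lawOfDensity (xiDensity σ F G) := by
  rw [lawOfDensity, ← withDensity_indicator measurableSet_Ioi]
  refine withDensity_congr_ae ?_
  filter_upwards [hint, Measure.ae_ne volume (0 : ℝ)] with t ht ht0
  rcases lt_or_gt_of_ne ht0 with h | h
  · rw [indicator_of_notMem (show t ∉ Ioi 0 from not_lt.2 h.le)]
    have hcdf : cdf G t = 0 := by
      rw [cdf_eq_real, measureReal_eq_zero_iff]
      refine measure_mono_null (fun x hx => ?_) hG0
      exact not_le.2 (lt_of_le_of_lt hx h)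
    rw [meanDensity, hcdf]
    simp
  · rw [indicator_of_mem (show t ∈ Ioi 0 from h), meanDensity_thinned hσ0 hσ1 hG h ht]

lemma measurable_xiDensity (σ : ℝ) (F G : Measure ℝ) [IsFiniteMeasure F] :
    Measurable (xiDensity σ F G) := by
  have h1 : Measurable (cdf G) := (monotone_cdf G).measurable
  have h2 := measurable_Phi F
  unfold xiDensity
  fun_prop

lemma xiDensity_nonneg {σ : ℝ} {F G : Measure ℝ} [IsProbabilityMeasure G] {x : ℝ} (hx : 0 ≤ x) :
    0 ≤ xiDensity σ F G x :=
  mul_nonneg (mul_nonneg (div_nonneg (Real.rpow_nonneg hx _) Real.pi_pos.le)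
    (sin_pi_mul_cdf_nonneg G x)) (Real.exp_pos _).le

/-! ### Scale mixtures of the exponential law -/

lemma mixIntegrand_eq {σ x y : ℝ} {F G : Measure ℝ} (hy : 0 < y) :
    mixIntegrand σ F G x y = Real.pi * (Real.exp (-(x / y)) / y * xiDensity σ F G y) := by
  have h : y ^ (σ - 1) = y ^ (σ - 2) * y := by
    rw [← Real.rpow_add_one hy.ne']
    congr 1
    ring
  rw [mixIntegrand, xiDensity, h]
  field_simp

/-- The factor `exp (-x / y) / y` is at most `1 / x`, so integrability of `ξ` suffices. -/
lemma integrableOn_mixIntegrand {σ : ℝ} {F G : Measure ℝ} [IsFiniteMeasure F]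
    (hξ : IntegrableOn (xiDensity σ F G) (Ioi 0)) {x : ℝ} (hx : 0 < x) :
    IntegrableOn (mixIntegrand σ F G x) (Ioi 0) := by
  have h1 : IntegrableOn
      (fun y => Real.pi * (Real.exp (-(x / y)) / y * xiDensity σ F G y)) (Ioi 0) := by
    refine Integrable.const_mul ?_ _
    refine Integrable.bdd_mul (c := 1 / x) hξ
      (by fun_prop : Measurable fun y : ℝ => Real.exp (-(x / y)) / y).aestronglyMeasurable ?_
    rw [ae_restrict_iff' measurableSet_Ioi]
    refine ae_of_all _ fun y hy => ?_
    have hy0 : 0 < y := hy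
    have h2 : x / y ≤ Real.exp (x / y) := by linarith [Real.add_one_le_exp (x / y)]
    rw [Real.norm_of_nonneg (by positivity), Real.exp_neg, div_le_div_iff₀ hy0 hx, one_mul,
      inv_mul_le_iff₀ (Real.exp_pos _)]
    rwa [div_le_iff₀ hy0] at h2
  refine h1.congr_fun (fun y hy => ?_) measurableSet_Ioi
  exact (mixIntegrand_eq hy).symm

/-- The law of the product of a standard exponential variable and an independent variable with
density `ξ`. -/
lemma map_exponential_mul_lawOfDensity {σ : ℝ} {F G : Measure ℝ} [IsProbabilityMeasure F]
    [IsProbabilityMeasure G] [IsProbabilityMeasure (lawOfDensity (xiDensity σ F G))]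
    (hξ : IntegrableOn (xiDensity σ F G) (Ioi 0)) :
    ((gammaLaw 1).prod (lawOfDensity (xiDensity σ F G))).map (fun q => q.1 * q.2) =
      lawOfDensity (mixDensity σ F G) := by
  have hγ := isProbabilityMeasure_gammaLaw zero_le_one
  have hξm : Measurable fun y => ENNReal.ofReal (xiDensity σ F G y) :=
    (measurable_xiDensity σ F G).ennreal_ofReal
  have hpdf : Measurable (gammaPDF 1 1) := by unfold gammaPDF; fun_prop
  ext A hA
  have hmul : Measurable fun q : ℝ × ℝ => q.1 * q.2 := by fun_prop
  have hinner : ∀ y ∈ Ioi (0 : ℝ), gammaLaw 1 ((fun g => g * y) ⁻¹' A) =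
      ∫⁻ x in Ioi 0, A.indicator 1 x * ENNReal.ofReal (Real.exp (-(x / y)) / y) := by
    intro y hy
    have hy0 : 0 < y := hy
    have hAy : MeasurableSet ((fun g => g * y) ⁻¹' A) := (measurable_mul_const y) hA
    have hf : Measurable (((fun g => g * y) ⁻¹' A).indicator (gammaPDF 1 1)) := hpdf.indicator hAy
    rw [gammaLaw_of_pos one_pos, gammaMeasure, withDensity_apply _ hAy, ← lintegral_indicator hAy]
    conv_lhs => rw [← Real.smul_map_volume_mul_left (inv_pos.2 hy0).ne']
    rw [lintegral_smul_measure, lintegral_map hf (by fun_prop),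
      ← lintegral_indicator measurableSet_Ioi, smul_eq_mul, abs_of_pos (inv_pos.2 hy0),
      ← lintegral_const_mul _ (by fun_prop)]
    refine lintegral_congr_ae ?_
    filter_upwards [Measure.ae_ne volume (0 : ℝ)] with x hx0
    have hxy : y⁻¹ * x * y = x := by field_simp
    have hind : ((fun g => g * y) ⁻¹' A).indicator (gammaPDF 1 1) (y⁻¹ * x) =
        A.indicator 1 x * gammaPDF 1 1 (y⁻¹ * x) := by
      by_cases hxA : x ∈ A
      · rw [indicator_of_mem (show y⁻¹ * x ∈ (fun g => g * y) ⁻¹' A by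
          rw [mem_preimage, hxy]; exact hxA), indicator_of_mem hxA, Pi.one_apply, one_mul]
      · rw [indicator_of_notMem (show y⁻¹ * x ∉ (fun g => g * y) ⁻¹' A by
          rw [mem_preimage, hxy]; exact hxA), indicator_of_notMem hxA, zero_mul]
    rw [hind]
    rcases lt_or_gt_of_ne hx0 with h | h
    · rw [indicator_of_notMem (show x ∉ Ioi 0 from not_lt.2 h.le),
        gammaPDF_of_neg (mul_neg_of_pos_of_neg (inv_pos.2 hy0) h)]
      simp
    · rw [indicator_of_mem (show x ∈ Ioi 0 from h), gammaPDF_of_nonneg (by positivity),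
        mul_left_comm, ← ENNReal.ofReal_mul (by positivity)]
      congr 2
      simp
      rw [div_eq_inv_mul, div_eq_inv_mul]
  have hjoint : Measurable fun q : ℝ × ℝ =>
      A.indicator (1 : ℝ → ℝ≥0∞) q.1 * ENNReal.ofReal (Real.exp (-(q.1 / q.2)) / q.2) := by
    have h1 : Measurable fun q : ℝ × ℝ => A.indicator (1 : ℝ → ℝ≥0∞) q.1 :=
      (measurable_one.indicator hA).comp measurable_fst
    fun_prop
  have hmix : ∀ x ∈ Ioi (0 : ℝ), ∫⁻ y in Ioi 0, ENNReal.ofReal (xiDensity σ F G y) *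
      (A.indicator 1 x * ENNReal.ofReal (Real.exp (-(x / y)) / y)) =
      A.indicator (fun x => ENNReal.ofReal (mixDensity σ F G x)) x := by
    intro x hx
    by_cases hxA : x ∈ A
    · simp only [indicator_of_mem hxA, Pi.one_apply, one_mul]
      rw [mixDensity, ← integral_const_mul, ofReal_integral_eq_lintegral_ofReal
        ((integrableOn_mixIntegrand hξ hx).const_mul _)]
      · refine setLIntegral_congr_fun measurableSet_Ioi fun y hy => ?_
        have hy0 : 0 < y := hy
        rw [← ENNReal.ofReal_mul (xiDensity_nonneg hy0.le), mixIntegrand_eq hy0]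
        congr 1
        field_simp
      · refine (ae_restrict_iff' measurableSet_Ioi).2 (ae_of_all _ fun y hy => ?_)
        beta_reduce
        have hy0 : 0 < y := hy
        have := xiDensity_nonneg (σ := σ) (F := F) (G := G) hy0.le
        have hpi := Real.pi_pos
        rw [Pi.zero_apply, mixIntegrand_eq hy0]
        positivity
    · simp [indicator_of_notMem hxA]
  calc ((gammaLaw 1).prod (lawOfDensity (xiDensity σ F G))).map (fun q => q.1 * q.2) A
      = ∫⁻ y, gammaLaw 1 ((fun g => g * y) ⁻¹' A) ∂lawOfDensity (xiDensity σ F G) := by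
        rw [Measure.map_apply hmul hA, Measure.prod_apply_symm (hmul hA)]
        rfl
    _ = ∫⁻ y in Ioi 0, ENNReal.ofReal (xiDensity σ F G y) *
          gammaLaw 1 ((fun g => g * y) ⁻¹' A) := by
        have hAm : Measurable fun y => gammaLaw 1 ((fun g => g * y) ⁻¹' A) :=
          measurable_measure_prodMk_right (hmul hA)
        rw [lawOfDensity, lintegral_withDensity_eq_lintegral_mul _ hξm hAm]
        rfl
    _ = ∫⁻ y in Ioi 0, ∫⁻ x in Ioi 0, ENNReal.ofReal (xiDensity σ F G y) *
          (A.indicator 1 x * ENNReal.ofReal (Real.exp (-(x / y)) / y)) := by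
        refine setLIntegral_congr_fun measurableSet_Ioi fun y hy => ?_
        have hjy : Measurable fun x => A.indicator (1 : ℝ → ℝ≥0∞) x *
            ENNReal.ofReal (Real.exp (-(x / y)) / y) := hjoint.comp measurable_prodMk_right
        rw [hinner y hy, lintegral_const_mul _ hjy]
    _ = ∫⁻ x in Ioi 0, ∫⁻ y in Ioi 0, ENNReal.ofReal (xiDensity σ F G y) *
          (A.indicator 1 x * ENNReal.ofReal (Real.exp (-(x / y)) / y)) :=
        lintegral_lintegral_swap
          ((hξm.comp measurable_fst).mul (hjoint.comp measurable_swap)).aemeasurable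
    _ = ∫⁻ x in Ioi 0, A.indicator (fun x => ENNReal.ofReal (mixDensity σ F G x)) x :=
        setLIntegral_congr_fun measurableSet_Ioi hmix
    _ = lawOfDensity (mixDensity σ F G) A := by
        rw [lintegral_indicator hA, lawOfDensity, withDensity_apply _ hA]

end DirichletMeans

/-! ### The laws of the two means and of their gamma mixtures -/

theorem theorem2p2
    (σ : ℝ) (hσ0 : 0 < σ) (hσ1 : σ ≤ 1)
    -- `X ≥ 0` with law `FX`, an independent Bernoulli variable `Y` with success probability `σ`,
    -- and the law `FXY` of the product `X Y`
    {Ω₀ : Type*} [MeasurableSpace Ω₀] (μ₀ : Measure Ω₀) [IsProbabilityMeasure μ₀]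
    (X Y : Ω₀ → ℝ) (FX FXY : Measure ℝ)
    (hX : HasLaw X FX μ₀) (hXnonneg : ∀ᵐ ω ∂μ₀, 0 ≤ X ω)
    (hY : HasLaw Y (bernoulliMeasure (1 : ℝ) 0 ⟨σ, hσ0.le, hσ1⟩) μ₀)
    (hXYindep : IndepFun X Y μ₀)
    (hXY : HasLaw (fun ω => X ω * Y ω) FXY μ₀)
    -- the Dirichlet means exist: `E log (1 + X) < ∞`
    (hlog : Integrable (fun x => Real.log (1 + x)) FX)
    -- the law of `X Y` has no jump of size one
    (hjump : ∀ x : ℝ, FXY {x} < 1)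
    -- a Dirichlet process with parameters `(1, FXY)` and an independent gamma variable
    {Ω₁ : Type*} [MeasurableSpace Ω₁] (μ₁ : Measure Ω₁) [IsProbabilityMeasure μ₁]
    (P₁ : Kernel Ω₁ ℝ) [IsMarkovKernel P₁]
    (hP₁ : DirichletMeans.IsDirichletProcess P₁ 1 FXY μ₁)
    (G₁ : Ω₁ → ℝ) (hG₁ : HasLaw G₁ (DirichletMeans.gammaLaw 1) μ₁)
    (hG₁indep : IndepFun G₁ (DirichletMeans.meanFunctional P₁) μ₁)
    -- a Dirichlet process with parameters `(σ, FX)` and independent beta and gamma variables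
    {Ω₂ : Type*} [MeasurableSpace Ω₂] (μ₂ : Measure Ω₂) [IsProbabilityMeasure μ₂]
    (P₂ : Kernel Ω₂ ℝ) [IsMarkovKernel P₂]
    (hP₂ : DirichletMeans.IsDirichletProcess P₂ σ FX μ₂)
    (B : Ω₂ → ℝ) (hB : HasLaw B (DirichletMeans.betaLaw σ (1 - σ)) μ₂)
    (hBindep : IndepFun B (DirichletMeans.meanFunctional P₂) μ₂)
    (G₂ : Ω₂ → ℝ) (hG₂ : HasLaw G₂ (DirichletMeans.gammaLaw σ) μ₂)
    (hG₂indep : IndepFun G₂ (DirichletMeans.meanFunctional P₂) μ₂) :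
    -- the random integrals defining the two means converge almost surely
    ((∀ᵐ ω ∂μ₁, Integrable (fun x : ℝ => x) (P₁ ω)) ∧
      (∀ᵐ ω ∂μ₂, Integrable (fun x : ℝ => x) (P₂ ω))) ∧
    -- `Φ_{F_X}` is finite almost everywhere on `(0, ∞)`
    (∀ᵐ x ∂(volume.restrict (Ioi (0 : ℝ))), Integrable (DirichletMeans.logKernel x) FX) ∧
    -- `M₁(F_{XY})` and `β M_σ(F_X)` have the same law, with density `ξ` on `(0, ∞)`
    (IdentDistrib (DirichletMeans.meanFunctional P₁)
        (fun ω => B ω * DirichletMeans.meanFunctional P₂ ω) μ₁ μ₂ ∧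
      HasLaw (DirichletMeans.meanFunctional P₁)
        (DirichletMeans.lawOfDensity (DirichletMeans.xiDensity σ FX FXY)) μ₁ ∧
      HasLaw (fun ω => B ω * DirichletMeans.meanFunctional P₂ ω)
        (DirichletMeans.lawOfDensity (DirichletMeans.xiDensity σ FX FXY)) μ₂) ∧
    -- the sine factor of the density
    (∀ x : ℝ, 0 < x → Real.sin (Real.pi * cdf FXY x) =
      if 0 < cdf FX x then Real.sin (Real.pi * σ * (1 - cdf FX x))
      else Real.sin (Real.pi * (1 - σ))) ∧
    -- the integral defining `g` converges on `(0, ∞)`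
    (∀ x : ℝ, 0 < x → IntegrableOn (DirichletMeans.mixIntegrand σ FX FXY x) (Ioi 0)) ∧
    -- `G_σ M_σ(F_X)` and `G₁ M₁(F_{XY})` have the same law, with density `g` on `(0, ∞)`
    (IdentDistrib (fun ω => G₂ ω * DirichletMeans.meanFunctional P₂ ω)
        (fun ω => G₁ ω * DirichletMeans.meanFunctional P₁ ω) μ₂ μ₁ ∧
      HasLaw (fun ω => G₂ ω * DirichletMeans.meanFunctional P₂ ω)
        (DirichletMeans.lawOfDensity (DirichletMeans.mixDensity σ FX FXY)) μ₂ ∧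
      HasLaw (fun ω => G₁ ω * DirichletMeans.meanFunctional P₁ ω)
        (DirichletMeans.lawOfDensity (DirichletMeans.mixDensity σ FX FXY)) μ₁) := by
  have hFX : IsProbabilityMeasure FX := hX.isProbabilityMeasure_iff.1 inferInstance
  have hFXY : IsProbabilityMeasure FXY := hXY.isProbabilityMeasure_iff.1 inferInstance
  have hFX0 : ∀ᵐ x ∂FX, 0 ≤ x := by
    rw [← hX.map_eq]
    exact (ae_map_iff (p := fun x : ℝ => 0 ≤ x) hX.aemeasurable measurableSet_Ici).2 hXnonneg
  have hthin := DirichletMeans.law_mul_bernoulli hσ0 hσ1 hX hY hXYindep hXY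
  have hFXY0 : ∀ᵐ x ∂FXY, 0 ≤ x := by
    rw [hthin, ae_add_measure_iff]
    refine ⟨Measure.ae_smul_measure hFX0 _, Measure.ae_smul_measure ?_ _⟩
    exact (ae_dirac_iff (p := fun x : ℝ => 0 ≤ x) measurableSet_Ici).2 le_rfl
  have hlogXY : Integrable (fun x => Real.log (1 + x)) FXY := by
    rw [hthin]
    exact (DirichletMeans.integral_thinned hσ0.le hσ1 hlog).1
  have hlogs : ∀ s, 0 ≤ s →
      ∫ x, Real.log (1 + s * x) ∂FXY = σ * ∫ x, Real.log (1 + s * x) ∂FX := by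
    intro s hs
    have hint : Integrable (fun x => Real.log (1 + s * x)) FX :=
      DirichletMeans.integrable_log_one_add_mul measurable_id hFX0 hlog hs
    -- the atom at the origin contributes `log 1 = 0`
    rw [hthin, (DirichletMeans.integral_thinned hσ0.le hσ1 hint).2]
    simp
  have hkernel := DirichletMeans.ae_integrable_logKernel hFX0 hlog
  obtain ⟨hM₁m, hM₁int, hM₁0, hMK₁⟩ :=
    DirichletMeans.meanFunctional_properties one_pos hP₁ hFXY0 hlogXY
  obtain ⟨hM₂m, hM₂int, hM₂0, hMK₂⟩ :=
    DirichletMeans.meanFunctional_properties hσ0 hP₂ hFX0 hlog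
  -- the laws of the two means
  set m₁ : Measure ℝ := μ₁.map (DirichletMeans.meanFunctional P₁) with hm₁
  set m₂ : Measure ℝ := μ₂.map (DirichletMeans.meanFunctional P₂) with hm₂
  have hm₁p : IsProbabilityMeasure m₁ := Measure.isProbabilityMeasure_map hM₁m.aemeasurable
  have hm₂p : IsProbabilityMeasure m₂ := Measure.isProbabilityMeasure_map hM₂m.aemeasurable
  have hlaw₁ : HasLaw (DirichletMeans.meanFunctional P₁) m₁ μ₁ := ⟨hM₁m.aemeasurable, rfl⟩
  have hlaw₂ : HasLaw (DirichletMeans.meanFunctional P₂) m₂ μ₂ := ⟨hM₂m.aemeasurable, rfl⟩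
  have hm₁0 : ∀ᵐ x ∂m₁, 0 ≤ x :=
    (ae_map_iff (p := fun x : ℝ => 0 ≤ x) hM₁m.aemeasurable measurableSet_Ici).2 hM₁0
  have hm₂0 : ∀ᵐ x ∂m₂, 0 ≤ x :=
    (ae_map_iff (p := fun x : ℝ => 0 ≤ x) hM₂m.aemeasurable measurableSet_Ici).2 hM₂0
  have hS₁ : ∀ s, 0 ≤ s → ∫ x, (1 + s * x) ^ (-1 : ℝ) ∂m₁ =
      Real.exp (-∫ x, Real.log (1 + s * x) ∂FXY) := by
    intro s hs
    rw [hm₁, integral_map hM₁m.aemeasurable (by fun_prop : Measurable _).aestronglyMeasurable,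
      hMK₁ s hs, neg_one_mul]
  have hS₂ : ∀ s, 0 ≤ s → ∫ x, (1 + s * x) ^ (-σ) ∂m₂ =
      Real.exp (-∫ x, Real.log (1 + s * x) ∂FXY) := by
    intro s hs
    rw [hm₂, integral_map hM₂m.aemeasurable (by fun_prop : Measurable _).aestronglyMeasurable,
      hMK₂ s hs, hlogs s hs, neg_mul]
  -- both `M₁` and `β M₂` have the Stieltjes transform that determines the density `ξ`
  have hξ₁ : m₁ = DirichletMeans.lawOfDensity (DirichletMeans.xiDensity σ FX FXY) := by
    rw [← DirichletMeans.withDensity_meanDensity_eq_lawOfDensity hσ0.le hσ1 hthin hFXY0 hkernel]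
    refine DirichletMeans.eq_withDensity_meanDensity hm₁0 hFXY0 hlogXY (fun s hs => ?_) hjump
    rw [← hS₁ s hs]
    simp only [Real.rpow_neg_one]
  have hβp := DirichletMeans.isProbabilityMeasure_betaLaw hσ0 hσ1
  have hlawN := DirichletMeans.hasLaw_mul_of_indepFun hB hlaw₂ hBindep
  have hξ₂ : ((DirichletMeans.betaLaw σ (1 - σ)).prod m₂).map (fun q => q.1 * q.2) =
      DirichletMeans.lawOfDensity (DirichletMeans.xiDensity σ FX FXY) := by
    have : IsProbabilityMeasure
        (((DirichletMeans.betaLaw σ (1 - σ)).prod m₂).map (fun q => q.1 * q.2)) :=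
      Measure.isProbabilityMeasure_map (by fun_prop)
    rw [← DirichletMeans.withDensity_meanDensity_eq_lawOfDensity hσ0.le hσ1 hthin hFXY0 hkernel]
    refine DirichletMeans.eq_withDensity_meanDensity
      (DirichletMeans.ae_map_mul_nonneg (DirichletMeans.ae_betaLaw_nonneg _ _) hm₂0)
      hFXY0 hlogXY (fun s hs => ?_) hjump
    rw [DirichletMeans.integral_inv_beta_mul hσ0 hσ1 hm₂0 hs, hS₂ s hs]
  rw [hξ₁] at hlaw₁
  rw [hξ₂] at hlawN
  have hξp : IsProbabilityMeasure
      (DirichletMeans.lawOfDensity (DirichletMeans.xiDensity σ FX FXY)) := hξ₁ ▸ hm₁p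
  have hξint : IntegrableOn (DirichletMeans.xiDensity σ FX FXY) (Ioi 0) := by
    refine ⟨(DirichletMeans.measurable_xiDensity σ FX FXY).aestronglyMeasurable, ?_⟩
    rw [hasFiniteIntegral_iff_ofReal ((ae_restrict_iff' measurableSet_Ioi).2
      (ae_of_all _ fun x hx => DirichletMeans.xiDensity_nonneg (le_of_lt hx)))]
    have h1 := measure_lt_top (DirichletMeans.lawOfDensity (DirichletMeans.xiDensity σ FX FXY)) univ
    rwa [DirichletMeans.lawOfDensity, withDensity_apply _ .univ, Measure.restrict_univ] at h1
  -- the two gamma mixtures have the same Laplace transform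
  have hγ₁ := DirichletMeans.isProbabilityMeasure_gammaLaw zero_le_one
  have hγ₂ := DirichletMeans.isProbabilityMeasure_gammaLaw hσ0.le
  have hmix₁ := DirichletMeans.hasLaw_mul_of_indepFun hG₁ hlaw₁ hG₁indep
  have hmix₂ := DirichletMeans.hasLaw_mul_of_indepFun hG₂ hlaw₂ hG₂indep
  have hgamma : ((DirichletMeans.gammaLaw σ).prod m₂).map (fun q => q.1 * q.2) =
      ((DirichletMeans.gammaLaw 1).prod m₁).map (fun q => q.1 * q.2) := by
    refine DirichletMeans.measure_eq_of_laplace_eq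
      (DirichletMeans.ae_map_mul_nonneg (DirichletMeans.ae_gammaLaw_nonneg hσ0.le) hm₂0)
      (DirichletMeans.ae_map_mul_nonneg (DirichletMeans.ae_gammaLaw_nonneg zero_le_one) hm₁0)
      fun n => ?_
    rw [DirichletMeans.integral_exp_gamma_mul hσ0.le hm₂0 n.cast_nonneg,
      DirichletMeans.integral_exp_gamma_mul zero_le_one hm₁0 n.cast_nonneg,
      hS₁ _ n.cast_nonneg, hS₂ _ n.cast_nonneg]
  rw [hgamma, hξ₁] at hmix₂
  rw [DirichletMeans.map_exponential_mul_lawOfDensity hξint] at hmix₁ hmix₂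
  exact ⟨⟨hM₁int, hM₂int⟩, ae_restrict_of_ae hkernel,
    ⟨⟨hlaw₁.aemeasurable, hlawN.aemeasurable, hlaw₁.map_eq.trans hlawN.map_eq.symm⟩,
      hlaw₁, hlawN⟩,
    fun x hx => DirichletMeans.sin_pi_mul_cdf_thinned hσ0.le hσ1 hthin hx,
    fun x hx => DirichletMeans.integrableOn_mixIntegrand hξint hx,
    ⟨hmix₂.aemeasurable, hmix₁.aemeasurable, hmix₂.map_eq.trans hmix₁.map_eq.symm⟩,
    hmix₂, hmix₁⟩
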